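/- Let $\mathbb{A}^3$ be $\mathbb{R}^3$ with a nonzero volume form $dV$, and let $\Sigma\subset\mathbb{A}^3$ be a smooth regular surface. For a smooth frame field $(\mathbf{e}_1,\mathbf{e}_2,\mathbf{e}_3)$ along a local parametrization $\mathbf{x}$ of $\Sigma$ that is unimodular, i.e. $dV(\mathbf{e}_1,\mathbf{e}_2,\mathbf{e}_3)=1$, define 1-forms by $d\mathbf{x}=\sum_i\mathbf{e}_i\,\omega^i$ and $d\mathbf{e}_j=\sum_i\mathbf{e}_i\,\omega^i_j$. The frame field is *0-adapted* if $\mathbf{e}_1,\mathbf{e}_2$ span the tangent planes; then $\omega^3=0$ and $\omega^3_i=\sum_{j\le 2}h_{ij}\,\omega^j$ for $i=1,2$. The surface is *hyperbolic* if $\det(h_{ij})<0$ everywhere. A 0-adapted frame field is *1-adapted* if $h_{11}=h_{22}=0$ and $h_{12}=h_{21}=1$, and *2-adapted* if moreover $\omega^3_3=0$; then $\omega^i_3=\sum_{j\le 2}\ell_{ij}\,\omega^3_j$ for $i=1,2$, with $\ell_{12}=\ell_{21}$. A hyperbolic surface is *affine flat* if the Gauss curvature of the metric $\mathrm{I}_{\mathrm{aff}}=\omega^3_1\circ\omega^1+\omega^3_2\circ\omega^2$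 (computed from 1-adapted frames, and independent of their choice) vanishes identically, and *affine minimal* if $H_{\mathrm{aff}}=\ell_{12}$ (computed from 2-adapted frames) vanishes identically. *Adapted asymptotic coordinates* on $\Sigma$ are a smooth regular local parametrization $\mathbf{x}(u,v)$ such that $\mathbf{x}_u,\mathbf{x}_v$ are, in one of the two orders, the first two vectors of a 2-adapted frame field; then the coordinate curves are asymptotic curves and $\mathrm{I}_{\mathrm{aff}}=2\,du\,dv$. **Corollary.** Let $\Sigma\subset\mathbb{A}^3$ be a hyperbolic affine flat, affine minimal surface. Then: 1. $\Sigma$ is a ruled surface: every point of $\Sigma$ has a neighborhood in $\Sigma$ with a smooth regular parametrization of the form $\mathbf{x}(u,v)=u\,\bar{\mathbf{e}}_1(v)+\bar{\mathbf{x}}(v)$ on a product $I\times J$ of open intervals, where $\bar{\mathbf{e}}_1,\bar{\mathbf{x}}:J\to\mathbb{R}^3$ are smooth and $\bar{\mathbf{e}}_1$ vanishes nowhere. 2. The parametrization in 1 can be chosen so that $(u,v)$ are adapted asymptotic coordinates; its $u$-parameter curves are then straight lines (line segments). 3. If $\mathbf{x}:I\times J\to\Sigma$ are any adapted asymptotic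 coordinates on $\Sigma$ defined on a product of open intervals, then, after interchanging the names of $u$ and $v$ if necessary, $\mathbf{x}(u,v)=u\,\bar{\mathbf{e}}_1(v)+\bar{\mathbf{x}}(v)$ throughout, with smooth $\bar{\mathbf{e}}_1,\bar{\mathbf{x}}$ and $\bar{\mathbf{e}}_1$ nowhere zero. -/

import Mathlib

open Set
open scoped ContDiff

namespace Equiaffine

/-- The vector space underlying equiaffine space `𝔸³`. -/
abbrev A3 : Type := Fin 3 → ℝ

/-- Volume forms on `𝔸³`: alternating trilinear forms (required to be nonzero where used). -/
abbrev VolumeForm : Type := A3 [⋀^Fin 3]→ₗ[ℝ] ℝ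

/-- `I` is an open interval of the real line (possibly unbounded). -/
def IsOpenInterval (I : Set ℝ) : Prop := IsOpen I ∧ I.OrdConnected

/-! ### Regular surfaces -/

/-- `x : U → S` is a smooth regular parametrization of a relatively open part of `S`:
`U ⊆ ℝ²` is open, `x` is `C^∞` on `U` with injective differential, and `x` is a homeomorphism
of `U` onto a relatively open subset of `S`. -/
structure IsLocalParam (S : Set A3) (U : Set (ℝ × ℝ)) (x : ℝ × ℝ → A3) : Prop where
  isOpen : IsOpen U
  smooth : ContDiffOn ℝ ∞ x U
  immersion : ∀ q ∈ U, Function.Injective (fderiv ℝ x q)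
  injOn : InjOn x U
  open_image : ∀ O : Set (ℝ × ℝ), O ⊆ U → IsOpen O → ∃ W : Set A3, IsOpen W ∧ x '' O = S ∩ W

/-- Regular (embedded, smooth) surfaces in `𝔸³`. -/
def IsRegularSurface (S : Set A3) : Prop :=
  ∀ p ∈ S, ∃ (U : Set (ℝ × ℝ)) (x : ℝ × ℝ → A3), IsLocalParam S U x ∧ p ∈ x '' U

/-! ### Frame fields and Maurer-Cartan forms

The frame vectors `e₁, e₂, e₃` are `e q 0, e q 1, e q 2`. -/

/-- A smooth unimodular frame field along `U`. -/
structure IsUnimodularFrame (vol : VolumeForm) (U : Set (ℝ × ℝ))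
    (e : ℝ × ℝ → Fin 3 → A3) : Prop where
  smooth : ∀ i, ContDiffOn ℝ ∞ (fun q => e q i) U
  vol_eq_one : ∀ q ∈ U, vol (e q) = 1

/-- The `i`-th component of the vector `w` in the unimodular frame `F` (Cramer's rule);
see `sum_frameCoeff_smul`. -/
def frameCoeff (vol : VolumeForm) (F : Fin 3 → A3) (i : Fin 3) (w : A3) : ℝ :=
  vol (Function.update F i w)

theorem sum_frameCoeff_smul (vol : VolumeForm) (F : Fin 3 → A3) (hF : vol F = 1) (w : A3) :
    ∑ i, frameCoeff vol F i w • F i = w := by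
  have hli : LinearIndependent ℝ F := by
    by_contra h
    have := vol.map_linearDependent F h
    rw [hF] at this
    exact one_ne_zero this
  have hspan : Submodule.span ℝ (Set.range F) = ⊤ :=
    hli.span_eq_top_of_card_eq_finrank (by simp)
  have hw : w ∈ Submodule.span ℝ (Set.range F) := by
    rw [hspan]
    trivial
  obtain ⟨c, rfl⟩ := (Submodule.mem_span_range_iff_exists_fun ℝ).1 hw
  refine Finset.sum_congr rfl fun i _ => ?_
  congr 1
  unfold frameCoeff
  rw [AlternatingMap.map_update_sum]
  rw [Finset.sum_eq_single i]
  · rw [AlternatingMap.map_update_smul, Function.update_eq_self, hF, smul_eq_mul, mul_one]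
  · intro j _ hj
    rw [AlternatingMap.map_update_smul, AlternatingMap.map_update_self _ _ (Ne.symm hj), smul_zero]
  · intro h
    exact absurd (Finset.mem_univ i) h

/-- The dual form `ωⁱ` at `q`, applied to the tangent vector `w` of the parameter domain:
`dx = ∑ᵢ ωⁱ eᵢ`. -/
noncomputable def dualForm (vol : VolumeForm) (x : ℝ × ℝ → A3) (e : ℝ × ℝ → Fin 3 → A3)
    (i : Fin 3) (q w : ℝ × ℝ) : ℝ :=
  frameCoeff vol (e q) i (fderiv ℝ x q w)

/-- The connection form `ωⁱⱼ` at `q`, applied to `w`: `deⱼ = ∑ᵢ ωⁱⱼ eᵢ`. -/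
noncomputable def connForm (vol : VolumeForm) (e : ℝ × ℝ → Fin 3 → A3)
    (i j : Fin 3) (q w : ℝ × ℝ) : ℝ :=
  frameCoeff vol (e q) i (fderiv ℝ (fun q' => e q' j) q w)

/-- 0-adapted frame fields: unimodular, with `e₁, e₂` spanning the tangent plane. -/
structure IsZeroAdapted (vol : VolumeForm) (x : ℝ × ℝ → A3) (U : Set (ℝ × ℝ))
    (e : ℝ × ℝ → Fin 3 → A3) : Prop extends IsUnimodularFrame vol U e where
  span_eq : ∀ q ∈ U, Submodule.span ℝ {e q 0, e q 1} = LinearMap.range (fderiv ℝ x q).toLinearMap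

/-- `h` is the matrix `[hᵢⱼ]` of the frame field `e` at `q`: `ω³ᵢ = ∑ⱼ hᵢⱼ ωʲ` for `i, j ∈ {1, 2}`.
For a 0-adapted frame field there is exactly one such matrix. -/
def IsHMatrix (vol : VolumeForm) (x : ℝ × ℝ → A3) (e : ℝ × ℝ → Fin 3 → A3) (q : ℝ × ℝ)
    (h : Matrix (Fin 2) (Fin 2) ℝ) : Prop :=
  ∀ (i : Fin 2) (w : ℝ × ℝ), connForm vol e 2 i.castSucc q w =
    ∑ j : Fin 2, h i j * dualForm vol x e j.castSucc q w

/-- The surface is hyperbolic: `det [hᵢⱼ] < 0` everywhere, for 0-adapted frames. -/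
def IsHyperbolic (vol : VolumeForm) (S : Set A3) : Prop :=
  ∀ (U : Set (ℝ × ℝ)) (x : ℝ × ℝ → A3) (e : ℝ × ℝ → Fin 3 → A3),
    IsLocalParam S U x → IsZeroAdapted vol x U e →
      ∀ q ∈ U, ∀ h : Matrix (Fin 2) (Fin 2) ℝ, IsHMatrix vol x e q h → h.det < 0

/-- 1-adapted frame fields (on a hyperbolic surface): `h₁₁ = h₂₂ = 0`, `h₁₂ = h₂₁ = 1`. -/
structure IsOneAdapted (vol : VolumeForm) (x : ℝ × ℝ → A3) (U : Set (ℝ × ℝ))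
    (e : ℝ × ℝ → Fin 3 → A3) : Prop extends IsZeroAdapted vol x U e where
  h_eq : ∀ q ∈ U, IsHMatrix vol x e q !![0, 1; 1, 0]

/-- 2-adapted frame fields: 1-adapted with `ω³₃ = 0`. -/
structure IsTwoAdapted (vol : VolumeForm) (x : ℝ × ℝ → A3) (U : Set (ℝ × ℝ))
    (e : ℝ × ℝ → Fin 3 → A3) : Prop extends IsOneAdapted vol x U e where
  conn33_eq_zero : ∀ q ∈ U, ∀ w : ℝ × ℝ, connForm vol e 2 2 q w = 0

/-! ### Affine Gauss curvature -/

/-- The coordinate vectors `∂/∂u`, `∂/∂v` of the parameter plane. -/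
def coordVec (i : Fin 2) : ℝ × ℝ := if i = 0 then (1, 0) else (0, 1)

/-- Partial derivatives of scalar functions on the parameter plane. -/
noncomputable def pd (i : Fin 2) (f : ℝ × ℝ → ℝ) (q : ℝ × ℝ) : ℝ := fderiv ℝ f q (coordVec i)

/-- Christoffel symbols of the first kind,
`[ij, k] = (∂ᵢ gⱼₖ + ∂ⱼ gᵢₖ - ∂ₖ gᵢⱼ) / 2`, of a (pseudo-)Riemannian metric in coordinates. -/
noncomputable def christoffel (g : ℝ × ℝ → Matrix (Fin 2) (Fin 2) ℝ) (i j k : Fin 2)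
    (q : ℝ × ℝ) : ℝ :=
  (pd i (fun q' => g q' j k) q + pd j (fun q' => g q' i k) q - pd k (fun q' => g q' i j) q) / 2

/-- The component `R₁₂₁₂` of the Riemann curvature tensor of `g`, given by
`R_{ijkl} = (∂ⱼ∂ₖ g_{il} + ∂ᵢ∂ₗ g_{jk} - ∂ᵢ∂ₖ g_{jl} - ∂ⱼ∂ₗ g_{ik}) / 2
  + ∑ g^{mn} ([jk, m] [il, n] - [jl, m] [ik, n])`. -/
noncomputable def riemann1212 (g : ℝ × ℝ → Matrix (Fin 2) (Fin 2) ℝ) (q : ℝ × ℝ) : ℝ :=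
  (pd 1 (pd 0 fun q' => g q' 0 1) q + pd 0 (pd 1 fun q' => g q' 1 0) q
      - pd 0 (pd 0 fun q' => g q' 1 1) q - pd 1 (pd 1 fun q' => g q' 0 0) q) / 2
    + ∑ m, ∑ n, (g q)⁻¹ m n * (christoffel g 1 0 m q * christoffel g 0 1 n q
        - christoffel g 1 1 m q * christoffel g 0 0 n q)

/-- The Gauss curvature `K = R₁₂₁₂ / det g` of a two-dimensional metric. -/
noncomputable def gaussCurvature (g : ℝ × ℝ → Matrix (Fin 2) (Fin 2) ℝ) (q : ℝ × ℝ) : ℝ :=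
  riemann1212 g q / (g q).det

/-- The coordinate matrix of the affine first fundamental form
`I_aff = ω³₁ ∘ ω¹ + ω³₂ ∘ ω²` (symmetric products). -/
noncomputable def affineFirstForm (vol : VolumeForm) (x : ℝ × ℝ → A3) (e : ℝ × ℝ → Fin 3 → A3)
    (q : ℝ × ℝ) : Matrix (Fin 2) (Fin 2) ℝ :=
  Matrix.of fun i j => ∑ a : Fin 2,
    (connForm vol e 2 a.castSucc q (coordVec i) * dualForm vol x e a.castSucc q (coordVec j)
      + connForm vol e 2 a.castSucc q (coordVec j) * dualForm vol x e a.castSucc q (coordVec i)) / 2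

/-- The (hyperbolic) surface is affine flat: the Gauss curvature `K_aff` of `I_aff`, computed from
1-adapted frame fields, vanishes identically. -/
def IsAffineFlat (vol : VolumeForm) (S : Set A3) : Prop :=
  ∀ (U : Set (ℝ × ℝ)) (x : ℝ × ℝ → A3) (e : ℝ × ℝ → Fin 3 → A3),
    IsLocalParam S U x → IsOneAdapted vol x U e →
      ∀ q ∈ U, gaussCurvature (affineFirstForm vol x e) q = 0

/-! ### Affine mean curvature -/

/-- `l` is the matrix `[ℓᵢⱼ]` of the frame field `e` at `q`: `ωⁱ₃ = ∑ⱼ ℓᵢⱼ ω³ⱼ` for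
`i, j ∈ {1, 2}`. For a 2-adapted frame field there is exactly one such matrix. -/
def IsLMatrix (vol : VolumeForm) (e : ℝ × ℝ → Fin 3 → A3) (q : ℝ × ℝ)
    (l : Matrix (Fin 2) (Fin 2) ℝ) : Prop :=
  ∀ (i : Fin 2) (w : ℝ × ℝ), connForm vol e i.castSucc 2 q w =
    ∑ j : Fin 2, l i j * connForm vol e 2 j.castSucc q w

/-- The (hyperbolic) surface is affine minimal: `H_aff = ℓ₁₂`, computed from 2-adapted frame
fields, vanishes identically. -/
def IsAffineMinimal (vol : VolumeForm) (S : Set A3) : Prop :=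
  ∀ (U : Set (ℝ × ℝ)) (x : ℝ × ℝ → A3) (e : ℝ × ℝ → Fin 3 → A3),
    IsLocalParam S U x → IsTwoAdapted vol x U e →
      ∀ q ∈ U, ∀ l : Matrix (Fin 2) (Fin 2) ℝ, IsLMatrix vol e q l → l 0 1 = 0

/-! ### Adapted asymptotic coordinates and ruled surfaces -/

/-- Adapted asymptotic coordinates on `S`: a local parametrization `x` whose coordinate vector
fields `x_u, x_v` are, in one of the two orders, the first two vectors of a 2-adapted frame field.
(So the coordinate curves are asymptotic and `I_aff = 2 du dv`. Which of the two families of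
asymptotic curves has to come first in a 2-adapted frame is decided by the sign of the volume
form, so both orders are allowed for the names `u`, `v` to be interchangeable.) -/
def IsAdaptedCoords (vol : VolumeForm) (S : Set A3) (U : Set (ℝ × ℝ)) (x : ℝ × ℝ → A3) : Prop :=
  IsLocalParam S U x ∧ ∃ e : ℝ × ℝ → Fin 3 → A3, IsTwoAdapted vol x U e ∧
    ((∀ q ∈ U, e q 0 = fderiv ℝ x q (1, 0) ∧ e q 1 = fderiv ℝ x q (0, 1)) ∨
     (∀ q ∈ U, e q 0 = fderiv ℝ x q (0, 1) ∧ e q 1 = fderiv ℝ x q (1, 0)))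

/-- On `I × J` the map is `x(u, v) = u e₁(v) + x₀(v)` with smooth `e₁`, `x₀` and `e₁` nowhere zero;
in particular the `u`-parameter curves are straight. -/
def IsStraightInU (I J : Set ℝ) (x : ℝ × ℝ → A3) : Prop :=
  ∃ e₁ x₀ : ℝ → A3, ContDiffOn ℝ ∞ e₁ J ∧ ContDiffOn ℝ ∞ x₀ J ∧ (∀ v ∈ J, e₁ v ≠ 0) ∧
    ∀ u ∈ I, ∀ v ∈ J, x (u, v) = u • e₁ v + x₀ v

/-- Ruled surfaces: near every point there is a regular parametrization
`(u, v) ↦ u e₁(v) + x₀(v)`. -/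
def IsRuledSurface (S : Set A3) : Prop :=
  ∀ p ∈ S, ∃ (I J : Set ℝ) (x : ℝ × ℝ → A3), IsOpenInterval I ∧ IsOpenInterval J ∧
    IsLocalParam S (I ×ˢ J) x ∧ p ∈ x '' (I ×ˢ J) ∧ IsStraightInU I J x

end Equiaffine

/-! Flatness supplies asymptotic coordinates, and minimality makes one family of coordinate lines
straight. Existence of coordinates. In a local parametrization with parameters `s`, `t`,
hyperbolicity says that the second-order form `vol(x_s, x_t, d²x)` is indefinite. It therefore
factors as `2 D ω¹ω²` with `ω¹ = a ds + b dt`, `ω² = c ds + d dt` and `D = ad - bc`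
(`exists_null_coframe`). The weight `D` is exactly what makes the dual frame unimodular and
1-adapted, with `I_aff = 2 ω¹ω²`. Write `dω¹ = φ ∧ ω¹`, `dω² = -φ ∧ ω²`. The curvature is `dφ` up to
a nonzero factor (`riemann1212_null_coframe`), so flatness gives `φ = df` locally, and `e^{-f} ω¹ =
du`, `e^{f} ω² = dv` are exact. The products `ω¹ω²` and `ω¹ ∧ ω²` are unchanged by this rescaling,
so `u`, `v` are asymptotic coordinates (`exists_isAsymptotic`). Straightness. In such coordinates
`vol(x_u, x_v, x_uv) = 1`, and differentiating this forces `x_uu = a x_v`, `x_vv = b x_u` (new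
functions `a`, `b`). The frame `x_u, x_v, x_uv` is then 2-adapted with `H_aff = ab`, so minimality
means `ab = 0`. Comparing the mixed derivatives of `x_uv` gives `a_vv = 0` and `b_uu = 0`. Smooth
functions with zero product may both be nonzero, but a function affine in `v` and one affine in `u`
cannot do this on a rectangle (`eq_zero_or_eq_zero_of_affine`). Hence `x_uu = 0` throughout or `x_vv
= 0` throughout (`straight_or_straight`), up to naming the conclusion. -/

namespace Equiaffine

/-! ### The volume form as a function of three vectors -/

/-- The volume spanned by three vectors. -/
def tri (vol : VolumeForm) (a b c : A3) : ℝ := vol ![a, b, c]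

theorem tri_eq (vol : VolumeForm) (a b c : A3) :
    tri vol a b c = vol (Pi.basisFun ℝ (Fin 3)) *
      (a 0 * b 1 * c 2 - a 0 * b 2 * c 1 - a 1 * b 0 * c 2 + a 1 * b 2 * c 0
        + a 2 * b 0 * c 1 - a 2 * b 1 * c 0) := by
  unfold tri
  conv_lhs => rw [AlternatingMap.eq_smul_basis_det (Pi.basisFun ℝ (Fin 3)) vol]
  rw [AlternatingMap.smul_apply, Pi.basisFun_det_apply, Matrix.det_fin_three, smul_eq_mul]
  simp

theorem basisVolume_ne_zero {vol : VolumeForm} (h : vol ≠ 0) : vol (Pi.basisFun ℝ (Fin 3)) ≠ 0 := by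
  intro h0
  apply h
  rw [AlternatingMap.eq_smul_basis_det (Pi.basisFun ℝ (Fin 3)) vol, h0, zero_smul]

theorem frameCoeff_zero (vol : VolumeForm) (F : Fin 3 → A3) (w : A3) :
    frameCoeff vol F 0 w = tri vol w (F 1) (F 2) := by
  unfold frameCoeff tri
  congr 1
  ext i : 1
  fin_cases i <;> simp

theorem frameCoeff_one (vol : VolumeForm) (F : Fin 3 → A3) (w : A3) :
    frameCoeff vol F 1 w = tri vol (F 0) w (F 2) := by
  unfold frameCoeff tri
  congr 1
  ext i : 1
  fin_cases i <;> simp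

theorem frameCoeff_two (vol : VolumeForm) (F : Fin 3 → A3) (w : A3) :
    frameCoeff vol F 2 w = tri vol (F 0) (F 1) w := by
  unfold frameCoeff tri
  congr 1
  ext i : 1
  fin_cases i <;> simp

theorem vol_eq_tri (vol : VolumeForm) (F : Fin 3 → A3) : vol F = tri vol (F 0) (F 1) (F 2) := by
  unfold tri
  congr 1
  ext i : 1
  fin_cases i <;> simp

theorem tri_expand (vol : VolumeForm) {a b c : A3} (h : tri vol a b c = 1) (w : A3) :
    w = tri vol w b c • a + tri vol a w c • b + tri vol a b w • c := by
  have := sum_frameCoeff_smul vol ![a, b, c] h w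
  rw [Fin.sum_univ_three, frameCoeff_zero, frameCoeff_one, frameCoeff_two] at this
  simpa using this.symm

theorem _root_.ContDiffOn.tri (vol : VolumeForm) {U : Set (ℝ × ℝ)} {f g h : ℝ × ℝ → A3}
    (hf : ContDiffOn ℝ ∞ f U) (hg : ContDiffOn ℝ ∞ g U) (hh : ContDiffOn ℝ ∞ h U) :
    ContDiffOn ℝ ∞ (fun q => tri vol (f q) (g q) (h q)) U := by
  rw [contDiffOn_pi] at hf hg hh
  have f0 := hf 0; have f1 := hf 1; have f2 := hf 2
  have g0 := hg 0; have g1 := hg 1; have g2 := hg 2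
  have h0 := hh 0; have h1 := hh 1; have h2 := hh 2
  simp only [tri_eq]
  fun_prop

/-! ### Partial derivatives -/

section Partial

variable {E : Type*} [NormedAddCommGroup E] [NormedSpace ℝ E]

/-- Partial derivatives of vector-valued functions on the parameter plane. -/
noncomputable def pdv (i : Fin 2) (F : ℝ × ℝ → E) (q : ℝ × ℝ) : E := fderiv ℝ F q (coordVec i)

theorem pd_eq_pdv : pd = pdv (E := ℝ) := rfl

theorem fderiv_apply_eq_pdv (F : ℝ × ℝ → E) (q w : ℝ × ℝ) :
    fderiv ℝ F q w = w.1 • pdv 0 F q + w.2 • pdv 1 F q := by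
  have : w = w.1 • coordVec 0 + w.2 • coordVec 1 := by
    ext <;> simp [coordVec]
  conv_lhs => rw [this]
  simp [pdv, map_add, map_smul]

variable {U : Set (ℝ × ℝ)} {F G : ℝ × ℝ → E} {q : ℝ × ℝ} {f g : ℝ × ℝ → ℝ}

theorem _root_.ContDiffOn.pdv (hU : IsOpen U) (hF : ContDiffOn ℝ ∞ F U) (i : Fin 2) :
    ContDiffOn ℝ ∞ (pdv i F) U :=
  (hF.fderiv_of_isOpen hU (by simp)).clm_apply contDiffOn_const

theorem _root_.ContDiffOn.differentiableAt_of_isOpen (hU : IsOpen U) (hF : ContDiffOn ℝ ∞ F U)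
    (hq : q ∈ U) : DifferentiableAt ℝ F q :=
  (hF.contDiffAt (hU.mem_nhds hq)).differentiableAt (by simp)

theorem pdv_congr (hU : IsOpen U) (h : ∀ q ∈ U, F q = G q) (i : Fin 2) (hq : q ∈ U) :
    pdv i F q = pdv i G q := by
  have : F =ᶠ[nhds q] G := Filter.eventually_of_mem (hU.mem_nhds hq) h
  rw [pdv, pdv, this.fderiv_eq]

theorem pdv_comm (hU : IsOpen U) (hF : ContDiffOn ℝ ∞ F U) (i j : Fin 2) (hq : q ∈ U) :
    pdv i (pdv j F) q = pdv j (pdv i F) q := by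
  have hd : DifferentiableAt ℝ (fderiv ℝ F) q :=
    (hF.fderiv_of_isOpen hU (m := ∞) (by simp)).differentiableAt_of_isOpen hU hq
  have key : ∀ i j, pdv i (pdv j F) q = fderiv ℝ (fderiv ℝ F) q (coordVec i) (coordVec j) := by
    intro i j
    unfold pdv
    rw [fderiv_clm_apply hd (differentiableAt_const _)]
    simp
  rw [key, key]
  exact (hF.contDiffAt (hU.mem_nhds hq)).isSymmSndFDerivAt
    (by rw [minSmoothness_of_isRCLikeNormedField]; exact WithTop.coe_le_coe.2 (le_top (a := (2 : ℕ∞)))) _ _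

theorem pdv_add (hF : DifferentiableAt ℝ F q) (hG : DifferentiableAt ℝ G q) (i : Fin 2) :
    pdv i (fun q => F q + G q) q = pdv i F q + pdv i G q := by
  unfold pdv
  rw [fderiv_fun_add hF hG]
  rfl

theorem pdv_smul (hf : DifferentiableAt ℝ f q) (hF : DifferentiableAt ℝ F q) (i : Fin 2) :
    pdv i (fun q => f q • F q) q = f q • pdv i F q + pdv i f q • F q := by
  unfold pdv
  rw [fderiv_fun_smul hf hF]
  simp

theorem pdv_smul_add_smul (hf : DifferentiableAt ℝ f q) (hF : DifferentiableAt ℝ F q)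
    (hg : DifferentiableAt ℝ g q) (hG : DifferentiableAt ℝ G q) (i : Fin 2) :
    pdv i (fun q => f q • F q + g q • G q) q =
      (f q • pdv i F q + pdv i f q • F q) + (g q • pdv i G q + pdv i g q • G q) := by
  rw [← pdv_smul hf hF, ← pdv_smul hg hG]
  exact pdv_add (hf.smul hF) (hg.smul hG) i

theorem pdv_mul (hf : DifferentiableAt ℝ f q) (hg : DifferentiableAt ℝ g q) (i : Fin 2) :
    pdv i (fun q => f q * g q) q = f q * pdv i g q + pdv i f q * g q := by
  simpa using pdv_smul hf hg i

theorem pdv_sub (hF : DifferentiableAt ℝ F q) (hG : DifferentiableAt ℝ G q) (i : Fin 2) :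
    pdv i (fun q => F q - G q) q = pdv i F q - pdv i G q := by
  unfold pdv
  rw [fderiv_fun_sub hF hG]
  rfl

theorem pdv_const (c : E) (i : Fin 2) : pdv i (fun _ : ℝ × ℝ => c) q = 0 := by
  simp [pdv]

theorem pdv_tri (vol : VolumeForm) {F G H : ℝ × ℝ → A3} (hF : DifferentiableAt ℝ F q)
    (hG : DifferentiableAt ℝ G q) (hH : DifferentiableAt ℝ H q) (i : Fin 2) :
    pdv i (fun q => tri vol (F q) (G q) (H q)) q = tri vol (pdv i F q) (G q) (H q)
      + tri vol (F q) (pdv i G q) (H q) + tri vol (F q) (G q) (pdv i H q) := by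
  have f := fun k => (hasFDerivAt_pi'.1 hF.hasFDerivAt) k
  have g := fun k => (hasFDerivAt_pi'.1 hG.hasFDerivAt) k
  have h := fun k => (hasFDerivAt_pi'.1 hH.hasFDerivAt) k
  have key := (((((((((f 0).mul (g 1)).mul (h 2)).sub (((f 0).mul (g 2)).mul (h 1))).sub
    (((f 1).mul (g 0)).mul (h 2))).add (((f 1).mul (g 2)).mul (h 0))).add
    (((f 2).mul (g 0)).mul (h 1))).sub (((f 2).mul (g 1)).mul (h 0))).const_mul
    (vol (Pi.basisFun ℝ (Fin 3))))
  have e : (fun q => tri vol (F q) (G q) (H q)) = _ := funext fun q => tri_eq vol _ _ _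
  rw [e]
  unfold pdv
  refine (congrArg (fun L => L (coordVec i)) (HasFDerivAt.fderiv key)).trans ?_
  simp [tri_eq]
  ring

end Partial

/-! ### Functions that are affine along one coordinate -/

section Affine

variable {E : Type*} [NormedAddCommGroup E] [NormedSpace ℝ E]

theorem eq_of_hasDerivAt_zero {I : Set ℝ} (hI : IsOpenInterval I) {g : ℝ → E}
    (hg : ∀ u ∈ I, HasDerivAt g 0 u) {u₀ u : ℝ} (h₀ : u₀ ∈ I) (hu : u ∈ I) : g u = g u₀ :=
  hI.1.is_const_of_deriv_eq_zero hI.2.isPreconnected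
    (fun w hw => (hg w hw).differentiableAt.differentiableWithinAt)
    (fun w hw => (hg w hw).deriv) hu h₀

theorem eq_affine_of_hasDerivAt {I : Set ℝ} (hI : IsOpenInterval I) {f g : ℝ → E}
    (hf : ∀ u ∈ I, HasDerivAt f (g u) u) (hg : ∀ u ∈ I, HasDerivAt g 0 u)
    {u₀ u : ℝ} (h₀ : u₀ ∈ I) (hu : u ∈ I) : f u = f u₀ + (u - u₀) • g u₀ := by
  have key : ∀ w ∈ I, HasDerivAt (fun w => f w - (w - u₀) • g u₀) 0 w := by
    intro w hw
    have h1 := (hf w hw).sub (((hasDerivAt_id w).sub_const u₀).smul_const (g u₀))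
    rwa [eq_of_hasDerivAt_zero hI hg h₀ hw, one_smul, sub_self] at h1
  have := eq_of_hasDerivAt_zero hI key h₀ hu
  simp only [sub_self, zero_smul, sub_zero] at this
  rw [← this]
  abel

theorem hasDerivAt_fst {F : ℝ × ℝ → E} {u v : ℝ} (h : DifferentiableAt ℝ F (u, v)) :
    HasDerivAt (fun u => F (u, v)) (pdv 0 F (u, v)) u := by
  have h1 : HasDerivAt (fun u : ℝ => (u, v)) ((1 : ℝ), (0 : ℝ)) u :=
    (hasDerivAt_id u).prodMk (hasDerivAt_const u v)
  exact h.hasFDerivAt.comp_hasDerivAt u h1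

theorem hasDerivAt_snd {F : ℝ × ℝ → E} {u v : ℝ} (h : DifferentiableAt ℝ F (u, v)) :
    HasDerivAt (fun v => F (u, v)) (pdv 1 F (u, v)) v := by
  have h1 : HasDerivAt (fun v : ℝ => (u, v)) ((0 : ℝ), (1 : ℝ)) v :=
    (hasDerivAt_const v u).prodMk (hasDerivAt_id v)
  exact h.hasFDerivAt.comp_hasDerivAt v h1

variable {I J : Set ℝ}

theorem eq_affine_fst (hI : IsOpenInterval I) (hJ : IsOpen J) {F : ℝ × ℝ → E}
    (hF : ContDiffOn ℝ ∞ F (I ×ˢ J)) (h2 : ∀ q ∈ I ×ˢ J, pdv 0 (pdv 0 F) q = 0)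
    {u₀ u v : ℝ} (h₀ : u₀ ∈ I) (hu : u ∈ I) (hv : v ∈ J) :
    F (u, v) = F (u₀, v) + (u - u₀) • pdv 0 F (u₀, v) := by
  have hU := hI.1.prod hJ
  refine eq_affine_of_hasDerivAt hI (f := fun u => F (u, v)) (g := fun u => pdv 0 F (u, v))
    (fun w hw => hasDerivAt_fst (hF.differentiableAt_of_isOpen hU ⟨hw, hv⟩)) ?_ h₀ hu
  intro w hw
  rw [← h2 (w, v) ⟨hw, hv⟩]
  exact hasDerivAt_fst ((hF.pdv hU 0).differentiableAt_of_isOpen hU ⟨hw, hv⟩)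

theorem eq_affine_snd (hI : IsOpen I) (hJ : IsOpenInterval J) {F : ℝ × ℝ → E}
    (hF : ContDiffOn ℝ ∞ F (I ×ˢ J)) (h2 : ∀ q ∈ I ×ˢ J, pdv 1 (pdv 1 F) q = 0)
    {u v₀ v : ℝ} (hu : u ∈ I) (h₀ : v₀ ∈ J) (hv : v ∈ J) :
    F (u, v) = F (u, v₀) + (v - v₀) • pdv 1 F (u, v₀) := by
  have hU := hI.prod hJ.1
  refine eq_affine_of_hasDerivAt hJ (f := fun v => F (u, v)) (g := fun v => pdv 1 F (u, v))
    (fun w hw => hasDerivAt_snd (hF.differentiableAt_of_isOpen hU ⟨hu, hw⟩)) ?_ h₀ hv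
  intro w hw
  rw [← h2 (u, w) ⟨hu, hw⟩]
  exact hasDerivAt_snd ((hF.pdv hU 1).differentiableAt_of_isOpen hU ⟨hu, hw⟩)

/-- If one of two functions is affine along each first-coordinate line, the other one along each
second-coordinate line, and their product vanishes, then one of them vanishes. -/
theorem eq_zero_or_eq_zero_of_affine (hI : IsOpenInterval I) (hJ : IsOpenInterval J)
    {a b : ℝ × ℝ → ℝ} (ha : ContDiffOn ℝ ∞ a (I ×ˢ J)) (hb : ContDiffOn ℝ ∞ b (I ×ˢ J))
    (hab : ∀ q ∈ I ×ˢ J, a q * b q = 0) (ha2 : ∀ q ∈ I ×ˢ J, pdv 1 (pdv 1 a) q = 0)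
    (hb2 : ∀ q ∈ I ×ˢ J, pdv 0 (pdv 0 b) q = 0) :
    (∀ q ∈ I ×ˢ J, a q = 0) ∨ (∀ q ∈ I ×ˢ J, b q = 0) := by
  have hU := hI.1.prod hJ.1
  by_contra! hcon
  obtain ⟨⟨⟨u₀, v₀⟩, ⟨hu₀, hv₀⟩, h0⟩, ⟨⟨u₁, v₁⟩, ⟨hu₁, hv₁⟩, h1⟩⟩ := hcon
  simp only at hu₀ hv₀ hu₁ hv₁
  have hda : ∀ q ∈ I ×ˢ J, DifferentiableAt ℝ a q := fun q hq =>
    ha.differentiableAt_of_isOpen hU hq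
  have hdb : ∀ q ∈ I ×ˢ J, DifferentiableAt ℝ b q := fun q hq =>
    hb.differentiableAt_of_isOpen hU hq
  -- If `b (u, v₁) ≠ 0`, then `a` vanishes near `v₁` on the line through `u`; being affine there it
  -- vanishes on the whole line, in particular at `v₀`.
  have key : ∀ u ∈ I, a (u, v₀) ≠ 0 → b (u, v₁) = 0 := by
    intro u hu hau
    by_contra hbu
    have hdv := hasDerivAt_snd (hda (u, v₁) ⟨hu, hv₁⟩)
    have hev : (fun v => a (u, v)) =ᶠ[nhds v₁] fun _ => 0 := by
      have hc := (hasDerivAt_snd (hdb (u, v₁) ⟨hu, hv₁⟩)).continuousAt.eventually_ne hbu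
      filter_upwards [hc, hJ.1.mem_nhds hv₁] with v hv hvJ
      exact (mul_eq_zero.1 (hab (u, v) ⟨hu, hvJ⟩)).resolve_right hv
    have hz : pdv 1 a (u, v₁) = 0 := by
      rw [← hdv.deriv, hev.deriv_eq, deriv_const]
    apply hau
    rw [eq_affine_snd hI.1 hJ ha ha2 hu hv₁ hv₀, hz, smul_zero, add_zero]
    exact hev.eq_of_nhds
  -- Now the same argument in the other direction: `a (u, v₀) ≠ 0` persists for `u` near `u₀`, so
  -- `b` vanishes on a piece of the line `v = v₁`, hence on all of it.
  have hev : (fun u => b (u, v₁)) =ᶠ[nhds u₀] fun _ => 0 := by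
    have hc := (hasDerivAt_fst (hda (u₀, v₀) ⟨hu₀, hv₀⟩)).continuousAt.eventually_ne h0
    filter_upwards [hc, hI.1.mem_nhds hu₀] with u hu huI
    exact key u huI hu
  have hdu := hasDerivAt_fst (hdb (u₀, v₁) ⟨hu₀, hv₁⟩)
  have hz : pdv 0 b (u₀, v₁) = 0 := by
    rw [← hdu.deriv, hev.deriv_eq, deriv_const]
  apply h1
  rw [eq_affine_fst hI hJ.1 hb hb2 hu₀ hu₁ hv₁, hz, smul_zero, add_zero]
  exact hev.eq_of_nhds

end Affine

/-- Parametrizations with vanishing second derivative along the `u`-curves are ruled. -/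
theorem isStraightInU_of_pdv_eq_zero {I J : Set ℝ} (hI : IsOpenInterval I) (hJ : IsOpenInterval J)
    {x : ℝ × ℝ → A3} (hx : ContDiffOn ℝ ∞ x (I ×ˢ J))
    (hne : ∀ q ∈ I ×ˢ J, pdv 0 x q ≠ 0) (h2 : ∀ q ∈ I ×ˢ J, pdv 0 (pdv 0 x) q = 0) :
    IsStraightInU I J x := by
  -- With `I` empty there is no base point, yet `e₁` must still be nonzero on `J`; a nonzero
  -- constant serves.
  rcases I.eq_empty_or_nonempty with rfl | ⟨u₀, hu₀⟩
  · exact ⟨fun _ => 1, fun _ => 0, contDiffOn_const, contDiffOn_const,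
      fun _ _ => one_ne_zero, fun u hu => hu.elim⟩
  have hU := hI.1.prod hJ.1
  have hmap : MapsTo (fun v : ℝ => (u₀, v)) J (I ×ˢ J) := fun v hv => ⟨hu₀, hv⟩
  have hsm : ContDiffOn ℝ ∞ (fun v : ℝ => (u₀, v)) J := contDiffOn_const.prodMk contDiffOn_id
  have h1 := (hx.pdv hU 0).comp hsm hmap
  refine ⟨fun v => pdv 0 x (u₀, v), fun v => x (u₀, v) - u₀ • pdv 0 x (u₀, v), h1,
    (hx.comp hsm hmap).sub (h1.const_smul u₀), fun v hv => hne _ ⟨hu₀, hv⟩, fun u hu v hv => ?_⟩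
  rw [eq_affine_fst hI hJ.1 hx h2 hu₀ hu hv]
  module

/-! ### Asymptotic coordinates -/

/-- The second-order equations of adapted asymptotic coordinates. -/
structure IsAsymptotic (vol : VolumeForm) (U : Set (ℝ × ℝ)) (x : ℝ × ℝ → A3) : Prop where
  isOpen : IsOpen U
  smooth : ContDiffOn ℝ ∞ x U
  uu : ∀ q ∈ U, tri vol (pdv 0 x q) (pdv 1 x q) (pdv 0 (pdv 0 x) q) = 0
  uv : ∀ q ∈ U, tri vol (pdv 0 x q) (pdv 1 x q) (pdv 1 (pdv 0 x) q) = 1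
  vv : ∀ q ∈ U, tri vol (pdv 0 x q) (pdv 1 x q) (pdv 1 (pdv 1 x) q) = 0

/-- The `e₃`-component of a vector is its volume against `e₁, e₂`. The third frame vector thus drops
out of `ω³ᵢ`, and the condition on `h` becomes one on second derivatives of `x` alone. -/
theorem IsOneAdapted.isAsymptotic {vol : VolumeForm} {U : Set (ℝ × ℝ)} {x : ℝ × ℝ → A3}
    {e : ℝ × ℝ → Fin 3 → A3} (hU : IsOpen U) (hx : ContDiffOn ℝ ∞ x U)
    (he : IsOneAdapted vol x U e) (h0 : ∀ q ∈ U, e q 0 = pdv 0 x q)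
    (h1 : ∀ q ∈ U, e q 1 = pdv 1 x q) : IsAsymptotic vol U x := by
  have hd0 : ∀ i, ∀ q ∈ U, pdv i (fun q => e q 0) q = pdv i (pdv 0 x) q := fun i q hq =>
    pdv_congr hU h0 i hq
  have hd1 : ∀ i, ∀ q ∈ U, pdv i (fun q => e q 1) q = pdv i (pdv 1 x) q := fun i q hq =>
    pdv_congr hU h1 i hq
  have hv : ∀ q ∈ U, tri vol (pdv 0 x q) (pdv 1 x q) (e q 2) = 1 := by
    intro q hq
    rw [← h0 q hq, ← h1 q hq, ← vol_eq_tri]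
    exact he.vol_eq_one q hq
  have hconn : ∀ q ∈ U, ∀ j k : Fin 2, tri vol (pdv 0 x q) (pdv 1 x q)
      (pdv k (fun q => e q j.castSucc) q) = !![(0 : ℝ), 1; 1, 0] j k := by
    intro q hq j k
    have := he.h_eq q hq j (coordVec k)
    unfold connForm dualForm at this
    rw [frameCoeff_two, h0 q hq, h1 q hq] at this
    refine this.trans ?_
    rw [Fin.sum_univ_two]
    have e0 : (Fin.castSucc 0 : Fin 3) = 0 := rfl
    have e1 : (Fin.castSucc 1 : Fin 3) = 1 := rfl
    rw [e0, e1, frameCoeff_zero, frameCoeff_one, h0 q hq, h1 q hq]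
    have hv' := hv q hq
    change _ * tri vol (pdv k x q) _ _ + _ * tri vol _ (pdv k x q) _ = _
    fin_cases j <;> fin_cases k <;> simp [hv'] <;> simp [tri_eq] <;> right <;> ring
  refine ⟨hU, hx, fun q hq => ?_, fun q hq => ?_, fun q hq => ?_⟩
  · rw [← hd0 0 q hq]
    exact hconn q hq 0 0
  · rw [← hd0 1 q hq]
    exact hconn q hq 0 1
  · rw [← hd1 1 q hq]
    exact hconn q hq 1 1

namespace IsAsymptotic

variable {vol : VolumeForm} {U : Set (ℝ × ℝ)} {x : ℝ × ℝ → A3}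

/-- The frame field `x_u, x_v, x_uv`. -/
noncomputable def frame (x : ℝ × ℝ → A3) (q : ℝ × ℝ) : Fin 3 → A3 :=
  ![pdv 0 x q, pdv 1 x q, pdv 1 (pdv 0 x) q]

/-- Vanishing volumes make `x_uu` and `x_vv` tangential. The normalization `vol(x_u, x_v, x_uv) =
1`, differentiated once, removes the `x_u`-component of `x_uu` and the `x_v`-component of `x_vv`. -/
theorem exists_structure_eqs (h : IsAsymptotic vol U x) :
    ∃ a b : ℝ × ℝ → ℝ, ContDiffOn ℝ ∞ a U ∧ ContDiffOn ℝ ∞ b U ∧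
      (∀ q ∈ U, pdv 0 (pdv 0 x) q = a q • pdv 1 x q) ∧
      (∀ q ∈ U, pdv 1 (pdv 1 x) q = b q • pdv 0 x q) := by
  have hU := h.isOpen
  have s0 := h.smooth.pdv hU 0
  have s1 := h.smooth.pdv hU 1
  have s00 := s0.pdv hU 0
  have s10 := s0.pdv hU 1
  have s11 := s1.pdv hU 1
  set p := fun q => tri vol (pdv 0 (pdv 0 x) q) (pdv 1 x q) (pdv 1 (pdv 0 x) q)
  set a := fun q => tri vol (pdv 0 x q) (pdv 0 (pdv 0 x) q) (pdv 1 (pdv 0 x) q)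
  set b := fun q => tri vol (pdv 1 (pdv 1 x) q) (pdv 1 x q) (pdv 1 (pdv 0 x) q)
  set r := fun q => tri vol (pdv 0 x q) (pdv 1 (pdv 1 x) q) (pdv 1 (pdv 0 x) q)
  have sp : ContDiffOn ℝ ∞ p U := ContDiffOn.tri vol s00 s1 s10
  have sa : ContDiffOn ℝ ∞ a U := ContDiffOn.tri vol s0 s00 s10
  have sb : ContDiffOn ℝ ∞ b U := ContDiffOn.tri vol s11 s1 s10
  have sr : ContDiffOn ℝ ∞ r U := ContDiffOn.tri vol s0 s11 s10
  have e00 : ∀ q ∈ U, pdv 0 (pdv 0 x) q = p q • pdv 0 x q + a q • pdv 1 x q := by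
    intro q hq
    have := tri_expand vol (h.uv q hq) (pdv 0 (pdv 0 x) q)
    rwa [h.uu q hq, zero_smul, add_zero] at this
  have e11 : ∀ q ∈ U, pdv 1 (pdv 1 x) q = b q • pdv 0 x q + r q • pdv 1 x q := by
    intro q hq
    have := tri_expand vol (h.uv q hq) (pdv 1 (pdv 1 x) q)
    rwa [h.vv q hq, zero_smul, add_zero] at this
  have D : ∀ {F : ℝ × ℝ → A3}, ContDiffOn ℝ ∞ F U → ∀ q ∈ U, DifferentiableAt ℝ F q :=
    fun hF q hq => hF.differentiableAt_of_isOpen hU hq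
  have D' : ∀ {F : ℝ × ℝ → ℝ}, ContDiffOn ℝ ∞ F U → ∀ q ∈ U, DifferentiableAt ℝ F q :=
    fun hF q hq => hF.differentiableAt_of_isOpen hU hq
  have hp0 : ∀ q ∈ U, p q = 0 := by
    intro q hq
    -- The `u`-derivative of `vol(x_u, x_v, x_uv) = 1` reads `0 = p + 0 + p`: the last term is the
    -- volume of `x_u, x_v, ∂_v(p x_u + a x_v)`.
    have d1 := pdv_tri vol (D s0 q hq) (D s1 q hq) (D s10 q hq) 0
    rw [pdv_congr hU h.uv 0 hq, pdv_const, pdv_comm hU s0 0 1 hq, pdv_congr hU e00 1 hq,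
      pdv_smul_add_smul (D' sp q hq) (D s0 q hq) (D' sa q hq) (D s1 q hq),
      pdv_comm hU h.smooth 0 1 hq] at d1
    have u1 := h.uv q hq
    have u2 := h.vv q hq
    have hpq : p q = tri vol (pdv 0 (pdv 0 x) q) (pdv 1 x q) (pdv 1 (pdv 0 x) q) := rfl
    rw [← hpq] at d1
    simp only [tri_eq, Pi.add_apply, Pi.smul_apply, smul_eq_mul] at d1 u1 u2
    linear_combination (-1/2) * d1 - (1/2) * p q * u1 - (1/2) * a q * u2
  have hr0 : ∀ q ∈ U, r q = 0 := by
    intro q hq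
    have d1 := pdv_tri vol (D s0 q hq) (D s1 q hq) (D s10 q hq) 1
    -- Rewriting `x_uvv` as `∂_u x_vv` lets the expansion of `x_vv` be used; the `v`-derivative of
    -- the normalization then reads `0 = 2r`.
    have hc : pdv 1 (pdv 1 (pdv 0 x)) q = pdv 0 (pdv 1 (pdv 1 x)) q := by
      rw [pdv_comm hU s1 0 1 hq]
      exact pdv_congr hU (fun q hq => pdv_comm hU h.smooth 1 0 hq) 1 hq
    rw [pdv_congr hU h.uv 1 hq, pdv_const, hc, pdv_congr hU e11 0 hq,
      pdv_smul_add_smul (D' sb q hq) (D s0 q hq) (D' sr q hq) (D s1 q hq),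
      pdv_comm hU h.smooth 0 1 hq] at d1
    have u1 := h.uv q hq
    have u2 := h.uu q hq
    have hrq : r q = tri vol (pdv 0 x q) (pdv 1 (pdv 1 x) q) (pdv 1 (pdv 0 x) q) := rfl
    rw [← hrq] at d1
    simp only [tri_eq, Pi.add_apply, Pi.smul_apply, smul_eq_mul] at d1 u1 u2
    linear_combination (-1/2) * d1 - (1/2) * r q * u1 - (1/2) * b q * u2
  refine ⟨a, b, sa, sb, fun q hq => ?_, fun q hq => ?_⟩
  · rw [e00 q hq, hp0 q hq, zero_smul, zero_add]
  · rw [e11 q hq, hr0 q hq, zero_smul, add_zero]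

end IsAsymptotic

/-! ### The 2-adapted frame of asymptotic coordinates, and affine minimality -/

namespace IsAsymptotic

variable {vol : VolumeForm} {U : Set (ℝ × ℝ)} {x : ℝ × ℝ → A3} {a b : ℝ × ℝ → ℝ} {q : ℝ × ℝ}

theorem pdv_zero_uv (h : IsAsymptotic vol U x) (ha : ContDiffOn ℝ ∞ a U)
    (h0 : ∀ q ∈ U, pdv 0 (pdv 0 x) q = a q • pdv 1 x q)
    (h1 : ∀ q ∈ U, pdv 1 (pdv 1 x) q = b q • pdv 0 x q) (hq : q ∈ U) :
    pdv 0 (pdv 1 (pdv 0 x)) q = (a q * b q) • pdv 0 x q + pdv 1 a q • pdv 1 x q := by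
  have hU := h.isOpen
  rw [pdv_comm hU (h.smooth.pdv hU 0) 0 1 hq, pdv_congr hU h0 1 hq,
    pdv_smul (ha.differentiableAt_of_isOpen hU hq)
      ((h.smooth.pdv hU 1).differentiableAt_of_isOpen hU hq), h1 q hq, mul_smul]

theorem pdv_one_uv (h : IsAsymptotic vol U x) (hb : ContDiffOn ℝ ∞ b U)
    (h0 : ∀ q ∈ U, pdv 0 (pdv 0 x) q = a q • pdv 1 x q)
    (h1 : ∀ q ∈ U, pdv 1 (pdv 1 x) q = b q • pdv 0 x q) (hq : q ∈ U) :
    pdv 1 (pdv 1 (pdv 0 x)) q = pdv 0 b q • pdv 0 x q + (a q * b q) • pdv 1 x q := by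
  have hU := h.isOpen
  rw [pdv_congr hU (fun q hq => pdv_comm hU h.smooth 1 0 hq) 1 hq,
    pdv_comm hU (h.smooth.pdv hU 1) 1 0 hq, pdv_congr hU h1 0 hq,
    pdv_smul (hb.differentiableAt_of_isOpen hU hq)
      ((h.smooth.pdv hU 0).differentiableAt_of_isOpen hU hq), h0 q hq, smul_smul, mul_comm (b q),
    add_comm]

theorem connForm_frame (j : Fin 2) (i : Fin 3) (q w : ℝ × ℝ) :
    connForm vol (frame x) i j.castSucc q w = frameCoeff vol (frame x q) i
      (w.1 • pdv 0 (pdv j x) q + w.2 • pdv 1 (pdv j x) q) := by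
  rw [← fderiv_apply_eq_pdv]
  fin_cases j <;> rfl

theorem connForm_frame_two (i : Fin 3) (q w : ℝ × ℝ) :
    connForm vol (frame x) i 2 q w = frameCoeff vol (frame x q) i
      (w.1 • pdv 0 (pdv 1 (pdv 0 x)) q + w.2 • pdv 1 (pdv 1 (pdv 0 x)) q) := by
  rw [← fderiv_apply_eq_pdv]
  rfl

theorem frame_isOneAdapted (h : IsAsymptotic vol U x) : IsOneAdapted vol x U (frame x) := by
  have hU := h.isOpen
  have s0 := h.smooth.pdv hU 0
  refine ⟨⟨⟨?_, fun q hq => ?_⟩, fun q hq => ?_⟩, fun q hq => ?_⟩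
  · intro i
    fin_cases i
    · exact s0
    · exact h.smooth.pdv hU 1
    · exact s0.pdv hU 1
  · rw [vol_eq_tri]
    exact h.uv q hq
  · ext z
    rw [Submodule.mem_span_pair, LinearMap.mem_range]
    constructor
    · rintro ⟨s, t, rfl⟩
      exact ⟨(s, t), fderiv_apply_eq_pdv x q (s, t)⟩
    · rintro ⟨w, rfl⟩
      exact ⟨w.1, w.2, (fderiv_apply_eq_pdv x q w).symm⟩
  · intro i w
    have huu := h.uu q hq
    have huv := h.uv q hq
    have hvv := h.vv q hq
    have e0 : (Fin.castSucc 0 : Fin 3) = 0 := rfl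
    have e1 : (Fin.castSucc 1 : Fin 3) = 1 := rfl
    rw [connForm_frame, Fin.sum_univ_two]
    unfold dualForm
    rw [e0, e1, frameCoeff_zero, frameCoeff_one, frameCoeff_two, fderiv_apply_eq_pdv]
    simp only [frame, Matrix.cons_val_zero, Matrix.cons_val_one, Matrix.cons_val]
    rw [tri_eq] at huu huv hvv
    fin_cases i
    · simp only [Fin.zero_eta, Matrix.of_apply, Matrix.cons_val_zero, Matrix.cons_val_one,
        tri_eq, Pi.add_apply, Pi.smul_apply, smul_eq_mul]
      linear_combination w.1 * huu
    · simp only [Fin.mk_one, Matrix.of_apply, Matrix.cons_val_zero, Matrix.cons_val_one,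
        tri_eq, Pi.add_apply, Pi.smul_apply, smul_eq_mul, pdv_comm hU h.smooth 0 1 hq]
      linear_combination w.2 * hvv

/-- Both first derivatives of `x_uv` are tangential by the structure equations, which is `ω³₃ = 0`.
-/
theorem frame_isTwoAdapted (h : IsAsymptotic vol U x) : IsTwoAdapted vol x U (frame x) := by
  refine ⟨h.frame_isOneAdapted, fun q hq w => ?_⟩
  obtain ⟨a, b, ha, hb, h0, h1⟩ := h.exists_structure_eqs
  rw [connForm_frame_two, frameCoeff_two, h.pdv_zero_uv ha h0 h1 hq, h.pdv_one_uv hb h0 h1 hq]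
  simp only [frame, Matrix.cons_val_zero, Matrix.cons_val_one, tri_eq, Pi.add_apply,
    Pi.smul_apply, smul_eq_mul]
  ring

/-- Here `ω³₁ = ω² = dv` and `ω³₂ = ω¹ = du`, so the `du`-coefficients of `ωⁱ₃` land in the second
column. The off-diagonal entry shows `H_aff = ab`. -/
theorem isLMatrix_frame (h : IsAsymptotic vol U x) (ha : ContDiffOn ℝ ∞ a U)
    (hb : ContDiffOn ℝ ∞ b U)
    (h0 : ∀ q ∈ U, pdv 0 (pdv 0 x) q = a q • pdv 1 x q)
    (h1 : ∀ q ∈ U, pdv 1 (pdv 1 x) q = b q • pdv 0 x q) (hq : q ∈ U) :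
    IsLMatrix vol (frame x) q !![pdv 0 b q, a q * b q; a q * b q, pdv 1 a q] := by
  intro i w
  have huv := h.uv q hq
  have e0 : (Fin.castSucc 0 : Fin 3) = 0 := rfl
  have e1 : (Fin.castSucc 1 : Fin 3) = 1 := rfl
  rw [connForm_frame_two, h.pdv_zero_uv ha h0 h1 hq, h.pdv_one_uv hb h0 h1 hq, Fin.sum_univ_two,
    h.frame_isOneAdapted.h_eq q hq, h.frame_isOneAdapted.h_eq q hq, Fin.sum_univ_two,
    Fin.sum_univ_two]
  unfold dualForm
  rw [e0, e1, frameCoeff_zero, frameCoeff_one, fderiv_apply_eq_pdv]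
  rw [tri_eq] at huv
  fin_cases i
  · simp only [Fin.zero_eta, e0, frameCoeff_zero]
    simp [frame, tri_eq]
    ring
  · simp only [Fin.mk_one, e1, frameCoeff_one]
    simp [frame, tri_eq]
    ring

/-- Minimality is `ab = 0`; the integrability condition for `x_uv` makes `a` affine in `v` and `b`
affine in `u`, so one of them is identically zero on the rectangle. -/
theorem straight_or_straight {S : Set A3} {I J : Set ℝ} (hI : IsOpenInterval I)
    (hJ : IsOpenInterval J) (hmin : IsAffineMinimal vol S) (hx : IsLocalParam S (I ×ˢ J) x)
    (h : IsAsymptotic vol (I ×ˢ J) x) :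
    (∀ q ∈ I ×ˢ J, pdv 0 (pdv 0 x) q = 0) ∨ (∀ q ∈ I ×ˢ J, pdv 1 (pdv 1 x) q = 0) := by
  obtain ⟨a, b, ha, hb, h0, h1⟩ := h.exists_structure_eqs
  have hU := h.isOpen
  have hab : ∀ q ∈ I ×ˢ J, a q * b q = 0 := fun q hq =>
    hmin _ _ _ hx h.frame_isTwoAdapted q hq _ (h.isLMatrix_frame ha hb h0 h1 hq)
  have c0 : ∀ q ∈ I ×ˢ J, pdv 0 (pdv 1 (pdv 0 x)) q = pdv 1 a q • pdv 1 x q := by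
    intro q hq
    rw [h.pdv_zero_uv ha h0 h1 hq, hab q hq, zero_smul, zero_add]
  have c1 : ∀ q ∈ I ×ˢ J, pdv 1 (pdv 1 (pdv 0 x)) q = pdv 0 b q • pdv 0 x q := by
    intro q hq
    rw [h.pdv_one_uv hb h0 h1 hq, hab q hq, zero_smul, add_zero]
  -- Where `f ≠ 0`, the factor `g` vanishes on a neighborhood, so its derivatives vanish too. This
  -- will kill the cross terms `a b_u` and `b a_v`.
  have hprod : ∀ {f g : ℝ × ℝ → ℝ}, ContDiffOn ℝ ∞ f (I ×ˢ J) → (∀ q ∈ I ×ˢ J, f q * g q = 0) →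
      ∀ i, ∀ q ∈ I ×ˢ J, f q * pdv i g q = 0 := by
    intro f g hf hfg i q hq
    by_cases hfq : f q = 0
    · rw [hfq, zero_mul]
    have hev : g =ᶠ[nhds q] fun _ => 0 := by
      filter_upwards [(hf.continuousOn.continuousAt (hU.mem_nhds hq)).eventually_ne hfq,
        hU.mem_nhds hq] with r hr hrU
      exact (mul_eq_zero.1 (hfg r hrU)).resolve_left hr
    rw [pdv, hev.fderiv_eq]
    simp
  have hba : ∀ q ∈ I ×ˢ J, b q * a q = 0 := fun q hq => by rw [mul_comm, hab q hq]
  -- Equality of mixed derivatives of `x_uv` is `∂_v(a_v x_v) = ∂_u(b_u x_u)`. Without the cross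
  -- terms this is `a_vv x_v = b_uu x_u`, and `x_u, x_v` are independent.
  have hcompat : ∀ q ∈ I ×ˢ J, pdv 1 (pdv 1 a) q = 0 ∧ pdv 0 (pdv 0 b) q = 0 := by
    intro q hq
    have s0 := h.smooth.pdv hU 0
    have hc := pdv_comm hU (s0.pdv hU 1) 0 1 hq
    rw [pdv_congr hU c0 1 hq, pdv_congr hU c1 0 hq,
      pdv_smul ((ha.pdv hU 1).differentiableAt_of_isOpen hU hq)
        ((h.smooth.pdv hU 1).differentiableAt_of_isOpen hU hq),
      pdv_smul ((hb.pdv hU 0).differentiableAt_of_isOpen hU hq)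
        (s0.differentiableAt_of_isOpen hU hq), h0 q hq, h1 q hq, smul_smul, smul_smul,
      mul_comm _ (a q), mul_comm _ (b q), hprod ha hab 0 q hq, hprod hb hba 1 q hq] at hc
    have huv := h.uv q hq
    have t0 := congrArg (fun z => tri vol z (pdv 1 x q) (pdv 1 (pdv 0 x) q)) hc
    have t1 := congrArg (fun z => tri vol (pdv 0 x q) z (pdv 1 (pdv 0 x) q)) hc
    simp only [tri_eq, Pi.add_apply, Pi.smul_apply, smul_eq_mul, zero_mul, zero_add] at huv t0 t1
    constructor
    · linear_combination -t1 - pdv 1 (pdv 1 a) q * huv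
    · linear_combination t0 - pdv 0 (pdv 0 b) q * huv
  rcases eq_zero_or_eq_zero_of_affine hI hJ ha hb hab (fun q hq => (hcompat q hq).1)
    (fun q hq => (hcompat q hq).2) with hz | hz
  · exact Or.inl fun q hq => by rw [h0 q hq, hz q hq, zero_smul]
  · exact Or.inr fun q hq => by rw [h1 q hq, hz q hq, zero_smul]

end IsAsymptotic

/-! ### Changes of parameters -/

/-- `ψ` is a diffeomorphism of the open set `V` onto an open subset of `U`. -/
structure IsReparam (V U : Set (ℝ × ℝ)) (ψ : ℝ × ℝ → ℝ × ℝ) : Prop where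
  isOpen : IsOpen V
  smooth : ContDiffOn ℝ ∞ ψ V
  mapsTo : MapsTo ψ V U
  injOn : InjOn ψ V
  open_image : ∀ O ⊆ V, IsOpen O → IsOpen (ψ '' O)
  bijective : ∀ q ∈ V, Function.Bijective (fderiv ℝ ψ q)

namespace IsReparam

variable {V U : Set (ℝ × ℝ)} {ψ : ℝ × ℝ → ℝ × ℝ} {q : ℝ × ℝ}
  {E : Type*} [NormedAddCommGroup E] [NormedSpace ℝ E]

theorem fderiv_comp (hψ : IsReparam V U ψ) (hU : IsOpen U) {F : ℝ × ℝ → E}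
    (hF : ContDiffOn ℝ ∞ F U) (hq : q ∈ V) :
    fderiv ℝ (F ∘ ψ) q = (fderiv ℝ F (ψ q)).comp (fderiv ℝ ψ q) :=
  _root_.fderiv_comp q (hF.differentiableAt_of_isOpen hU (hψ.mapsTo hq))
    ((hψ.smooth.contDiffAt (hψ.isOpen.mem_nhds hq)).differentiableAt (by simp))

theorem isLocalParam (hψ : IsReparam V U ψ) {S : Set A3} {x : ℝ × ℝ → A3}
    (hx : IsLocalParam S U x) : IsLocalParam S V (x ∘ ψ) := by
  refine ⟨hψ.isOpen, hx.smooth.comp hψ.smooth hψ.mapsTo, fun q hq => ?_,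
    hx.injOn.comp hψ.injOn hψ.mapsTo, fun O hO hOo => ?_⟩
  · rw [hψ.fderiv_comp hx.isOpen hx.smooth hq]
    exact (hx.immersion _ (hψ.mapsTo hq)).comp (hψ.bijective q hq).injective
  · rw [image_comp]
    exact hx.open_image _ (image_subset_iff.2 fun q hq => hψ.mapsTo (hO hq))
      (hψ.open_image O hO hOo)

theorem connForm_comp (hψ : IsReparam V U ψ) (hU : IsOpen U) (vol : VolumeForm)
    {e : ℝ × ℝ → Fin 3 → A3} (he : ∀ i, ContDiffOn ℝ ∞ (fun q => e q i) U) (hq : q ∈ V)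
    (i j : Fin 3) (w : ℝ × ℝ) :
    connForm vol (e ∘ ψ) i j q w = connForm vol e i j (ψ q) (fderiv ℝ ψ q w) := by
  unfold connForm
  have : (fun q => (e ∘ ψ) q j) = (fun q => e q j) ∘ ψ := rfl
  rw [this, hψ.fderiv_comp hU (he j) hq]
  rfl

theorem isOneAdapted (hψ : IsReparam V U ψ) (hU : IsOpen U) {vol : VolumeForm}
    {x : ℝ × ℝ → A3} (hx : ContDiffOn ℝ ∞ x U) {e : ℝ × ℝ → Fin 3 → A3}
    (he : IsOneAdapted vol x U e) : IsOneAdapted vol (x ∘ ψ) V (e ∘ ψ) := by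
  refine ⟨⟨⟨fun i => (he.smooth i).comp hψ.smooth hψ.mapsTo,
    fun q hq => he.vol_eq_one _ (hψ.mapsTo hq)⟩, fun q hq => ?_⟩, fun q hq i w => ?_⟩
  · rw [hψ.fderiv_comp hU hx hq]
    refine (he.span_eq _ (hψ.mapsTo hq)).trans ?_
    exact (LinearMap.range_comp_of_range_eq_top _
      (LinearMap.range_eq_top.2 (hψ.bijective q hq).surjective)).symm
  · rw [hψ.connForm_comp hU vol he.smooth hq, he.h_eq _ (hψ.mapsTo hq)]
    unfold dualForm
    rw [hψ.fderiv_comp hU hx hq]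
    rfl

theorem isTwoAdapted (hψ : IsReparam V U ψ) (hU : IsOpen U) {vol : VolumeForm}
    {x : ℝ × ℝ → A3} (hx : ContDiffOn ℝ ∞ x U) {e : ℝ × ℝ → Fin 3 → A3}
    (he : IsTwoAdapted vol x U e) : IsTwoAdapted vol (x ∘ ψ) V (e ∘ ψ) := by
  refine ⟨hψ.isOneAdapted hU hx he.toIsOneAdapted, fun q hq w => ?_⟩
  rw [hψ.connForm_comp hU vol he.smooth hq]
  exact he.conn33_eq_zero _ (hψ.mapsTo hq) _

theorem id_of_subset (hV : IsOpen V) (h : V ⊆ U) : IsReparam V U id :=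
  ⟨hV, contDiff_id.contDiffOn, h, injOn_id V, fun O _ hO => by rwa [image_id],
    fun q _ => by rw [fderiv_id]; exact Function.bijective_id⟩

theorem swap {I J : Set ℝ} (hI : IsOpen I) (hJ : IsOpen J) :
    IsReparam (J ×ˢ I) (I ×ˢ J) Prod.swap := by
  refine ⟨hJ.prod hI, (ContinuousLinearEquiv.prodComm ℝ ℝ ℝ).contDiff.contDiffOn,
    fun q hq => ⟨hq.2, hq.1⟩, Prod.swap_injective.injOn,
    fun O _ hO => (Homeomorph.prodComm ℝ ℝ).isOpenMap O hO,
    fun q _ => ?_⟩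
  have : fderiv ℝ (Prod.swap : ℝ × ℝ → ℝ × ℝ) q =
      (ContinuousLinearEquiv.prodComm ℝ ℝ ℝ : ℝ × ℝ →L[ℝ] ℝ × ℝ) :=
    (ContinuousLinearEquiv.prodComm ℝ ℝ ℝ).hasFDerivAt.fderiv
  rw [this]
  exact (ContinuousLinearEquiv.prodComm ℝ ℝ ℝ).bijective

end IsReparam

theorem fderiv_comp_swap {E : Type*} [NormedAddCommGroup E] [NormedSpace ℝ E]
    (F : ℝ × ℝ → E) (q w : ℝ × ℝ) :
    fderiv ℝ (F ∘ Prod.swap) q w = fderiv ℝ F q.swap w.swap := by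
  have := (ContinuousLinearEquiv.prodComm ℝ ℝ ℝ).comp_right_fderiv (f := F) (x := q)
  exact congrArg (fun L => L w) this

theorem pdv_zero_comp_swap {E : Type*} [NormedAddCommGroup E] [NormedSpace ℝ E]
    (F : ℝ × ℝ → E) : pdv 0 (F ∘ Prod.swap) = pdv 1 F ∘ Prod.swap :=
  funext fun q => fderiv_comp_swap F q (coordVec 0)

theorem pdv_one_comp_swap {E : Type*} [NormedAddCommGroup E] [NormedSpace ℝ E]
    (F : ℝ × ℝ → E) : pdv 1 (F ∘ Prod.swap) = pdv 0 F ∘ Prod.swap :=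
  funext fun q => fderiv_comp_swap F q (coordVec 1)

theorem IsLocalParam.pdv_ne_zero {S : Set A3} {U : Set (ℝ × ℝ)} {x : ℝ × ℝ → A3}
    (hx : IsLocalParam S U x) {q : ℝ × ℝ} (hq : q ∈ U) (i : Fin 2) : pdv i x q ≠ 0 := by
  intro h
  have := hx.immersion q hq (h.trans (map_zero (fderiv ℝ x q)).symm)
  fin_cases i <;> simp [coordVec] at this

theorem IsAsymptotic.isAdaptedCoords {vol : VolumeForm} {S : Set A3} {U : Set (ℝ × ℝ)}
    {x : ℝ × ℝ → A3} (h : IsAsymptotic vol U x) (hx : IsLocalParam S U x) :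
    IsAdaptedCoords vol S U x :=
  ⟨hx, frame x, h.frame_isTwoAdapted, Or.inl fun _ _ => ⟨rfl, rfl⟩⟩

theorem IsAdaptedCoords.swap {vol : VolumeForm} {S : Set A3} {I J : Set ℝ} {x : ℝ × ℝ → A3}
    (hI : IsOpen I) (hJ : IsOpen J) (h : IsAdaptedCoords vol S (I ×ˢ J) x) :
    IsAdaptedCoords vol S (J ×ˢ I) (x ∘ Prod.swap) := by
  obtain ⟨hx, e, he, ho⟩ := h
  have hs := IsReparam.swap hI hJ
  refine ⟨hs.isLocalParam hx, e ∘ Prod.swap, hs.isTwoAdapted hx.isOpen hx.smooth he, ?_⟩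
  simp only [fderiv_comp_swap]
  exact ho.symm.imp (fun h q hq => h _ (hs.mapsTo hq)) (fun h q hq => h _ (hs.mapsTo hq))

/-- In the second admitted order `x_v, x_u` come first in the frame; interchanging the parameters
turns it into the first order. -/
theorem IsAdaptedCoords.isAsymptotic_or_swap {vol : VolumeForm} {S : Set A3} {I J : Set ℝ}
    {x : ℝ × ℝ → A3} (hI : IsOpen I) (hJ : IsOpen J) (h : IsAdaptedCoords vol S (I ×ˢ J) x) :
    IsAsymptotic vol (I ×ˢ J) x ∨ IsAsymptotic vol (J ×ˢ I) (x ∘ Prod.swap) := by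
  obtain ⟨hx, e, he, ho⟩ := h
  have hs := IsReparam.swap hI hJ
  refine ho.imp (fun ho => ?_) (fun ho => ?_)
  · exact he.toIsOneAdapted.isAsymptotic hx.isOpen hx.smooth (fun q hq => (ho q hq).1)
      (fun q hq => (ho q hq).2)
  · have hx' := hs.isLocalParam hx
    refine (hs.isOneAdapted hx.isOpen hx.smooth he.toIsOneAdapted).isAsymptotic hx'.isOpen
      hx'.smooth (fun q hq => ?_) (fun q hq => ?_)
    · rw [pdv_zero_comp_swap]
      exact (ho _ (hs.mapsTo hq)).1
    · rw [pdv_one_comp_swap]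
      exact (ho _ (hs.mapsTo hq)).2

theorem IsAsymptotic.isStraightInU_or_swap {vol : VolumeForm} {S : Set A3} {I J : Set ℝ}
    {x : ℝ × ℝ → A3} (hI : IsOpenInterval I) (hJ : IsOpenInterval J)
    (hmin : IsAffineMinimal vol S) (hx : IsLocalParam S (I ×ˢ J) x)
    (h : IsAsymptotic vol (I ×ˢ J) x) :
    IsStraightInU I J x ∨ IsStraightInU J I (x ∘ Prod.swap) := by
  have hs := IsReparam.swap hI.1 hJ.1
  refine (h.straight_or_straight hI hJ hmin hx).imp (fun h2 => ?_) (fun h2 => ?_)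
  · exact isStraightInU_of_pdv_eq_zero hI hJ hx.smooth (fun q hq => hx.pdv_ne_zero hq 0) h2
  · have hx' := hs.isLocalParam hx
    refine isStraightInU_of_pdv_eq_zero hJ hI hx'.smooth (fun q hq => hx'.pdv_ne_zero hq 0)
      (fun q hq => ?_)
    rw [pdv_zero_comp_swap, pdv_zero_comp_swap]
    exact h2 _ (hs.mapsTo hq)

theorem IsAdaptedCoords.isStraightInU_or_swap {vol : VolumeForm} {S : Set A3} {I J : Set ℝ}
    {x : ℝ × ℝ → A3} (hI : IsOpenInterval I) (hJ : IsOpenInterval J)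
    (hmin : IsAffineMinimal vol S) (h : IsAdaptedCoords vol S (I ×ˢ J) x) :
    IsStraightInU I J x ∨ IsStraightInU J I (x ∘ Prod.swap) := by
  rcases h.isAsymptotic_or_swap hI.1 hJ.1 with ha | ha
  · exact ha.isStraightInU_or_swap hI hJ hmin h.1
  -- Swapping twice gives back `x`, so the two alternatives only change places.
  · exact (ha.isStraightInU_or_swap hJ hI hmin (h.swap hI.1 hJ.1).1).symm

/-! ### Null coframes of an indefinite quadratic form -/

/-- An indefinite binary form splits into two linear factors. The extra weight `D = ad - bc` forces
`D⁴ = m² - ln` on taking discriminants, so `D` may be the positive fourth root, and the factors can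
then be written down. -/
theorem exists_null_coframe {U : Set (ℝ × ℝ)} (hU : IsOpen U) {q₀ : ℝ × ℝ} (h₀ : q₀ ∈ U)
    {l m n : ℝ × ℝ → ℝ} (hl : ContDiffOn ℝ ∞ l U) (hm : ContDiffOn ℝ ∞ m U)
    (hn : ContDiffOn ℝ ∞ n U) (hdet : l q₀ * n q₀ - m q₀ * m q₀ < 0) :
    ∃ (V : Set (ℝ × ℝ)) (a b c d : ℝ × ℝ → ℝ), IsOpen V ∧ q₀ ∈ V ∧ V ⊆ U ∧
      ContDiffOn ℝ ∞ a V ∧ ContDiffOn ℝ ∞ b V ∧ ContDiffOn ℝ ∞ c V ∧ ContDiffOn ℝ ∞ d V ∧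
      ∀ q ∈ V, a q * d q - b q * c q ≠ 0 ∧
        (a q * d q - b q * c q) * (2 * (a q * c q)) = l q ∧
        (a q * d q - b q * c q) * (a q * d q + b q * c q) = m q ∧
        (a q * d q - b q * c q) * (2 * (b q * d q)) = n q := by
  set Δ : ℝ × ℝ → ℝ := fun q => m q * m q - l q * n q with hΔ
  have sΔ : ContDiffOn ℝ ∞ Δ U := (hm.mul hm).sub (hl.mul hn)
  obtain ⟨V₁, hV₁U, hV₁, hqV₁, hpos⟩ : ∃ V₁ ⊆ U, IsOpen V₁ ∧ q₀ ∈ V₁ ∧ ∀ q ∈ V₁, 0 < Δ q := by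
    have : ∀ᶠ q in nhds q₀, 0 < Δ q ∧ q ∈ U :=
      ((sΔ.continuousOn.continuousAt (hU.mem_nhds h₀)).eventually
        (lt_mem_nhds (by simp only [hΔ]; linarith))).and (hU.mem_nhds h₀)
    obtain ⟨V, hV, hVo, hq⟩ := eventually_nhds_iff.1 this
    exact ⟨V, fun q hq => (hV q hq).2, hVo, hq, fun q hq => (hV q hq).1⟩
  set D : ℝ × ℝ → ℝ := fun q => √(√(Δ q)) with hD
  have hDpos : ∀ q ∈ V₁, 0 < D q := fun q hq => Real.sqrt_pos.2 (Real.sqrt_pos.2 (hpos q hq))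
  have hD2 : ∀ q ∈ V₁, D q * D q = √(Δ q) := fun q hq => Real.mul_self_sqrt (Real.sqrt_nonneg _)
  have hD4 : ∀ q ∈ V₁, (D q * D q) * (D q * D q) = m q * m q - l q * n q := fun q hq => by
    rw [hD2 q hq, Real.mul_self_sqrt (hpos q hq).le]
  have sD : ContDiffOn ℝ ∞ D V₁ := ((sΔ.mono hV₁U).sqrt fun q hq => (hpos q hq).ne').sqrt
    fun q hq => (Real.sqrt_pos.2 (hpos q hq)).ne'
  replace hl := hl.mono hV₁U
  replace hm := hm.mono hV₁U
  replace hn := hn.mono hV₁U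
  -- Since `ln = (m + D²)(m - D²)`, either factor can serve as the denominator `s`. The sign of `m
  -- q₀` selects the one without cancellation, which is nonzero near `q₀`.
  rcases le_or_gt 0 (m q₀) with hm0 | hm0
  · set s : ℝ × ℝ → ℝ := fun q => m q + D q * D q with hs
    have ss : ContDiffOn ℝ ∞ s V₁ := hm.add (sD.mul sD)
    have hev : ∀ᶠ q in nhds q₀, s q ≠ 0 ∧ q ∈ V₁ :=
      ((ss.continuousOn.continuousAt (hV₁.mem_nhds hqV₁)).eventually_ne
        (by have := hDpos q₀ hqV₁; simp only [hs]; positivity)).and (hV₁.mem_nhds hqV₁)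
    obtain ⟨V, hV, hVo, hq⟩ := eventually_nhds_iff.1 hev
    have hVV : V ⊆ V₁ := fun q hq => (hV q hq).2
    have h2D : ∀ q ∈ V, 2 * D q ≠ 0 := fun q hq => mul_ne_zero two_ne_zero (hDpos q (hVV hq)).ne'
    have s2D : ContDiffOn ℝ ∞ (fun q => 2 * D q) V := contDiffOn_const.mul (sD.mono hVV)
    refine ⟨V, fun _ => 1, fun q => n q / s q, fun q => l q / (2 * D q), fun q => s q / (2 * D q),
      hVo, hq, hVV.trans hV₁U, contDiffOn_const, (hn.mono hVV).div (ss.mono hVV) fun q hq =>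
        (hV q hq).1, (hl.mono hVV).div s2D h2D, (ss.mono hVV).div s2D h2D, fun q hq => ?_⟩
    have hs0 := (hV q hq).1
    have hD0 := (hDpos q (hVV hq)).ne'
    have h4 := hD4 q (hVV hq)
    have hsq : s q = m q + D q * D q := rfl
    have hdet : 1 * (s q / (2 * D q)) - n q / s q * (l q / (2 * D q)) = D q := by
      field_simp
      rw [hsq]
      linear_combination -h4
    rw [hdet]
    refine ⟨hD0, by field_simp, ?_, by field_simp⟩
    have : 1 * (s q / (2 * D q)) + n q / s q * (l q / (2 * D q)) = 2 * (s q / (2 * D q)) - D q := by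
      linear_combination -hdet
    rw [this, hsq]
    field_simp
    ring
  · set s : ℝ × ℝ → ℝ := fun q => m q - D q * D q with hs
    have ss : ContDiffOn ℝ ∞ s V₁ := hm.sub (sD.mul sD)
    have hev : ∀ᶠ q in nhds q₀, s q ≠ 0 ∧ q ∈ V₁ :=
      ((ss.continuousOn.continuousAt (hV₁.mem_nhds hqV₁)).eventually_ne
        (by have := mul_self_nonneg (D q₀); simp only [hs]; linarith)).and (hV₁.mem_nhds hqV₁)
    obtain ⟨V, hV, hVo, hq⟩ := eventually_nhds_iff.1 hev
    have hVV : V ⊆ V₁ := fun q hq => (hV q hq).2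
    have h2D : ∀ q ∈ V, 2 * D q ≠ 0 := fun q hq => mul_ne_zero two_ne_zero (hDpos q (hVV hq)).ne'
    have s2D : ContDiffOn ℝ ∞ (fun q => 2 * D q) V := contDiffOn_const.mul (sD.mono hVV)
    refine ⟨V, fun q => l q / s q, fun _ => 1, fun q => s q / (2 * D q), fun q => n q / (2 * D q),
      hVo, hq, hVV.trans hV₁U, (hl.mono hVV).div (ss.mono hVV) fun q hq => (hV q hq).1,
      contDiffOn_const, (ss.mono hVV).div s2D h2D, (hn.mono hVV).div s2D h2D, fun q hq => ?_⟩
    have hs0 := (hV q hq).1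
    have hD0 := (hDpos q (hVV hq)).ne'
    have h4 := hD4 q (hVV hq)
    have hsq : s q = m q - D q * D q := rfl
    have hdet : l q / s q * (n q / (2 * D q)) - 1 * (s q / (2 * D q)) = D q := by
      field_simp
      rw [hsq]
      linear_combination h4
    rw [hdet]
    refine ⟨hD0, by field_simp, ?_, by field_simp⟩
    have : l q / s q * (n q / (2 * D q)) + 1 * (s q / (2 * D q)) = 2 * (s q / (2 * D q)) + D q := by
      linear_combination hdet
    rw [this, hsq]
    field_simp
    ring

/-! ### Curvature in terms of a null coframe -/

theorem gaussCurvature_congr {g g' : ℝ × ℝ → Matrix (Fin 2) (Fin 2) ℝ} {U : Set (ℝ × ℝ)}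
    (hU : IsOpen U) (h : ∀ q ∈ U, g q = g' q) {q : ℝ × ℝ} (hq : q ∈ U) :
    gaussCurvature g q = gaussCurvature g' q := by
  have h1 : ∀ i j k, ∀ q ∈ U, pd k (fun q' => g q' i j) q = pd k (fun q' => g' q' i j) q :=
    fun i j k q hq => pdv_congr hU (fun q hq => by rw [h q hq]) k hq
  have h2 : ∀ i j k p, pd p (pd k (fun q' => g q' i j)) q = pd p (pd k (fun q' => g' q' i j)) q :=
    fun i j k p => pdv_congr hU (h1 i j k) p hq
  simp only [gaussCurvature, riemann1212, christoffel, h1 _ _ _ q hq, h2, h q hq]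

theorem riemann1212_fin_two (E F G : ℝ × ℝ → ℝ) (q : ℝ × ℝ) :
    riemann1212 (fun q => !![E q, F q; F q, G q]) q =
      (pdv 1 (pdv 0 F) q + pdv 0 (pdv 1 F) q - pdv 0 (pdv 0 G) q - pdv 1 (pdv 1 E) q) / 2
      + (E q * G q - F q * F q)⁻¹ *
        (G q * (pdv 1 E q * pdv 1 E q - (2 * pdv 1 F q - pdv 0 G q) * pdv 0 E q)
        - F q * (pdv 1 E q * pdv 0 G q - (2 * pdv 1 F q - pdv 0 G q) * (2 * pdv 0 F q - pdv 1 E q)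
          + pdv 0 G q * pdv 1 E q - pdv 1 G q * pdv 0 E q)
        + E q * (pdv 0 G q * pdv 0 G q - pdv 1 G q * (2 * pdv 0 F q - pdv 1 E q))) / 4 := by
  simp only [riemann1212, christoffel, Fin.sum_univ_two, Matrix.inv_def, Matrix.adjugate_fin_two_of,
    Matrix.det_fin_two_of, Ring.inverse_eq_inv', Matrix.smul_apply, Matrix.of_apply,
    Matrix.cons_val_zero, Matrix.cons_val_one, smul_eq_mul, pd_eq_pdv]
  ring

section Curvature

variable {U : Set (ℝ × ℝ)} {q : ℝ × ℝ} {f g h k : ℝ × ℝ → ℝ}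

theorem pdv_mul_add_mul (hU : IsOpen U) (hf : ContDiffOn ℝ ∞ f U) (hg : ContDiffOn ℝ ∞ g U)
    (hh : ContDiffOn ℝ ∞ h U) (hk : ContDiffOn ℝ ∞ k U) (i : Fin 2) (hq : q ∈ U) :
    pdv i (fun q => f q * g q + h q * k q) q =
      (f q * pdv i g q + pdv i f q * g q) + (h q * pdv i k q + pdv i h q * k q) :=
  pdv_smul_add_smul (F := g) (G := k) (hf.differentiableAt_of_isOpen hU hq)
    (hg.differentiableAt_of_isOpen hU hq) (hh.differentiableAt_of_isOpen hU hq)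
    (hk.differentiableAt_of_isOpen hU hq) i

theorem pdv_mul_sub_mul (hU : IsOpen U) (hf : ContDiffOn ℝ ∞ f U) (hg : ContDiffOn ℝ ∞ g U)
    (hh : ContDiffOn ℝ ∞ h U) (hk : ContDiffOn ℝ ∞ k U) (i : Fin 2) (hq : q ∈ U) :
    pdv i (fun q => f q * g q - h q * k q) q =
      (f q * pdv i g q + pdv i f q * g q) - (h q * pdv i k q + pdv i h q * k q) := by
  have D : ∀ {F : ℝ × ℝ → ℝ}, ContDiffOn ℝ ∞ F U → DifferentiableAt ℝ F q :=
    fun hF => hF.differentiableAt_of_isOpen hU hq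
  rw [← pdv_mul (D hf) (D hg), ← pdv_mul (D hh) (D hk)]
  exact pdv_sub ((D hf).mul (D hg)) ((D hh).mul (D hk)) i

theorem pdv_pdv_mul_add_mul (hU : IsOpen U) (hf : ContDiffOn ℝ ∞ f U) (hg : ContDiffOn ℝ ∞ g U)
    (hh : ContDiffOn ℝ ∞ h U) (hk : ContDiffOn ℝ ∞ k U) (i j : Fin 2) (hq : q ∈ U) :
    pdv j (pdv i (fun q => f q * g q + h q * k q)) q =
      (f q * pdv j (pdv i g) q + pdv j f q * pdv i g q)
        + (pdv i f q * pdv j g q + pdv j (pdv i f) q * g q)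
      + ((h q * pdv j (pdv i k) q + pdv j h q * pdv i k q)
        + (pdv i h q * pdv j k q + pdv j (pdv i h) q * k q)) := by
  have df := hf.pdv hU i
  have dg := hg.pdv hU i
  have dh := hh.pdv hU i
  have dk := hk.pdv hU i
  rw [pdv_congr hU (fun q hq => pdv_mul_add_mul hU hf hg hh hk i hq) j hq,
    ← pdv_mul_add_mul hU hf dg df hg j hq, ← pdv_mul_add_mul hU hh dk dh hk j hq]
  exact pdv_add (((hf.mul dg).add (df.mul hg)).differentiableAt_of_isOpen hU hq)
    (((hh.mul dk).add (dh.mul hk)).differentiableAt_of_isOpen hU hq) j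

variable {a b c d A B : ℝ × ℝ → ℝ}

/-- The curvature of `2 (a ds + b dt) (c ds + d dt)` in terms of the connection form
`A ds + B dt`. -/
theorem riemann1212_null_coframe (hU : IsOpen U) (ha : ContDiffOn ℝ ∞ a U)
    (hb : ContDiffOn ℝ ∞ b U) (hc : ContDiffOn ℝ ∞ c U) (hd : ContDiffOn ℝ ∞ d U)
    (hA : ContDiffOn ℝ ∞ A U) (hB : ContDiffOn ℝ ∞ B U)
    (h1 : ∀ q ∈ U, pdv 0 b q - pdv 1 a q = A q * b q - B q * a q)
    (h2 : ∀ q ∈ U, pdv 0 d q - pdv 1 c q = B q * c q - A q * d q)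
    (hq : q ∈ U) (hD : a q * d q - b q * c q ≠ 0) :
    riemann1212 (fun q => !![a q * c q + a q * c q, a q * d q + b q * c q;
        a q * d q + b q * c q, b q * d q + b q * d q]) q =
      (a q * d q - b q * c q) * (pdv 0 B q - pdv 1 A q) := by
  have Df : ∀ {F : ℝ × ℝ → ℝ}, ContDiffOn ℝ ∞ F U → DifferentiableAt ℝ F q :=
    fun hF => hF.differentiableAt_of_isOpen hU hq
  -- `S` and `T` differentiate the structure equations `dω¹ = φ ∧ ω¹`, `dω² = -φ ∧ ω²`, where `φ = A
  -- ds + B dt`. After mixed partials are identified, these four relations eliminate the second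
  -- derivatives of the coframe from the curvature.
  have S : ∀ i, pdv i (pdv 0 b) q - pdv i (pdv 1 a) q =
      (A q * pdv i b q + pdv i A q * b q) - (B q * pdv i a q + pdv i B q * a q) := by
    intro i
    rw [← pdv_mul_sub_mul hU hA hb hB ha i hq, ← pdv_congr hU h1 i hq]
    exact (pdv_sub (Df (hb.pdv hU 0)) (Df (ha.pdv hU 1)) i).symm
  have T : ∀ i, pdv i (pdv 0 d) q - pdv i (pdv 1 c) q =
      (B q * pdv i c q + pdv i B q * c q) - (A q * pdv i d q + pdv i A q * d q) := by
    intro i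
    rw [← pdv_mul_sub_mul hU hB hc hA hd i hq, ← pdv_congr hU h2 i hq]
    exact (pdv_sub (Df (hd.pdv hU 0)) (Df (hc.pdv hU 1)) i).symm
  have S0 := S 0
  have S1 := S 1
  have T0 := T 0
  have T1 := T 1
  rw [riemann1212_fin_two]
  simp only [pdv_mul_add_mul hU ha hc ha hc _ hq, pdv_mul_add_mul hU ha hd hb hc _ hq,
    pdv_mul_add_mul hU hb hd hb hd _ hq, pdv_pdv_mul_add_mul hU ha hc ha hc _ _ hq,
    pdv_pdv_mul_add_mul hU ha hd hb hc _ _ hq, pdv_pdv_mul_add_mul hU hb hd hb hd _ _ hq]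
  rw [pdv_comm hU ha 1 0 hq, pdv_comm hU hc 1 0 hq]
  rw [pdv_comm hU hb 1 0 hq] at S1 ⊢
  rw [pdv_comm hU hd 1 0 hq] at T1 ⊢
  have g1 : pdv 0 b q = pdv 1 a q + (A q * b q - B q * a q) := by linear_combination h1 q hq
  have g2 : pdv 0 d q = pdv 1 c q + (B q * c q - A q * d q) := by linear_combination h2 q hq
  have hdet : (a q * c q + a q * c q) * (b q * d q + b q * d q) -
      (a q * d q + b q * c q) * (a q * d q + b q * c q) =
      -((a q * d q - b q * c q) * (a q * d q - b q * c q)) := by ring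
  rw [hdet, g1, g2]
  rw [g1] at S0
  rw [g2] at T0
  clear hdet g1 g2 h1 h2 S T Df
  have key : ∀ {P N R D : ℝ}, D ≠ 0 → P * (D * D) * 4 - N = R * (D * D) * 4 →
      P + (-(D * D))⁻¹ * N / 4 = R := by
    intro P N R D hD h
    field_simp
    linear_combination h
  apply key hD
  linear_combination (4 * (a q * d q - b q * c q) ^ 2) *
    (-d q * S0 - b q * T0 + a q * T1 + c q * S1)

end Curvature

/-- Smooth closed 1-forms on convex open sets have smooth primitives. -/
theorem exists_primitive {U : Set (ℝ × ℝ)} (hU : IsOpen U) (hc : Convex ℝ U) {P Q : ℝ × ℝ → ℝ}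
    (hP : ContDiffOn ℝ ∞ P U) (hQ : ContDiffOn ℝ ∞ Q U) (h : ∀ q ∈ U, pdv 0 Q q = pdv 1 P q) :
    ∃ f : ℝ × ℝ → ℝ, ContDiffOn ℝ ∞ f U ∧ ∀ q ∈ U, pdv 0 f q = P q ∧ pdv 1 f q = Q q := by
  set η : ℝ × ℝ → ℝ × ℝ →L[ℝ] ℝ := fun q =>
    P q • ContinuousLinearMap.fst ℝ ℝ ℝ + Q q • ContinuousLinearMap.snd ℝ ℝ ℝ with hη
  have hη_smooth : ContDiffOn ℝ ∞ η U := (hP.smul contDiffOn_const).add (hQ.smul contDiffOn_const)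
  -- Closedness of `P ds + Q dt` is symmetry of the derivative of `η`, the hypothesis of the
  -- Poincaré lemma used below.
  have hsymm : ∀ q ∈ U, ∀ z w, fderiv ℝ η q z w = fderiv ℝ η q w z := by
    intro q hq z w
    have hd : HasFDerivAt η ((fderiv ℝ P q).smulRight (ContinuousLinearMap.fst ℝ ℝ ℝ) +
        (fderiv ℝ Q q).smulRight (ContinuousLinearMap.snd ℝ ℝ ℝ)) q :=
      ((hP.differentiableAt_of_isOpen hU hq).hasFDerivAt.smul_const
        (ContinuousLinearMap.fst ℝ ℝ ℝ)).add
        ((hQ.differentiableAt_of_isOpen hU hq).hasFDerivAt.smul_const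
          (ContinuousLinearMap.snd ℝ ℝ ℝ))
    rw [hd.fderiv]
    simp only [add_apply, ContinuousLinearMap.smulRight_apply,
      smul_apply, ContinuousLinearMap.coe_fst', ContinuousLinearMap.coe_snd',
      smul_eq_mul, fderiv_apply_eq_pdv, h q hq]
    ring
  obtain ⟨f, hf⟩ := hc.exists_forall_hasFDerivAt_of_fderiv_symmetric hU
    (fun q hq => (hη_smooth.differentiableAt_of_isOpen hU hq).differentiableWithinAt) hsymm
  refine ⟨f, ?_, fun q hq => ?_⟩
  · rw [contDiffOn_infty_iff_fderiv_of_isOpen hU]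
    exact ⟨fun q hq => (hf q hq).differentiableAt.differentiableWithinAt,
      hη_smooth.congr fun q hq => (hf q hq).fderiv⟩
  · unfold pdv
    rw [(hf q hq).fderiv]
    simp [hη, coordVec]

/-- Two functions with independent differentials are local coordinates. -/
theorem exists_isReparam {U : Set (ℝ × ℝ)} (hU : IsOpen U) {q₀ : ℝ × ℝ} (h₀ : q₀ ∈ U)
    {u v : ℝ × ℝ → ℝ} (hu : ContDiffOn ℝ ∞ u U) (hv : ContDiffOn ℝ ∞ v U)
    (hJ : ∀ q ∈ U, pdv 0 u q * pdv 1 v q - pdv 1 u q * pdv 0 v q ≠ 0) :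
    ∃ (I J : Set ℝ) (ψ : ℝ × ℝ → ℝ × ℝ), IsOpenInterval I ∧ IsOpenInterval J ∧
      IsReparam (I ×ˢ J) U ψ ∧ q₀ ∈ ψ '' (I ×ˢ J) ∧ ∀ r ∈ I ×ˢ J, ∀ w,
        fderiv ℝ u (ψ r) (fderiv ℝ ψ r w) = w.1 ∧ fderiv ℝ v (ψ r) (fderiv ℝ ψ r w) = w.2 := by
  set Ψ : ℝ × ℝ → ℝ × ℝ := fun q => (u q, v q) with hΨ
  have sΨ : ContDiffOn ℝ ∞ Ψ U := hu.prodMk hv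
  have hd : ∀ q ∈ U, HasFDerivAt Ψ ((fderiv ℝ u q).prod (fderiv ℝ v q)) q := fun q hq =>
    (hu.differentiableAt_of_isOpen hU hq).hasFDerivAt.prodMk
      (hv.differentiableAt_of_isOpen hU hq).hasFDerivAt
  have hequiv : ∀ q ∈ U, ∃ L : (ℝ × ℝ) ≃L[ℝ] ℝ × ℝ, HasFDerivAt Ψ (L : ℝ × ℝ →L[ℝ] ℝ × ℝ) q := by
    intro q hq
    have hinj : Function.Injective ((fderiv ℝ u q).prod (fderiv ℝ v q)).toLinearMap := by
      rw [← LinearMap.ker_eq_bot, LinearMap.ker_eq_bot']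
      intro w hw
      have h1 : fderiv ℝ u q w = 0 := congrArg Prod.fst hw
      have h2 : fderiv ℝ v q w = 0 := congrArg Prod.snd hw
      rw [fderiv_apply_eq_pdv, smul_eq_mul, smul_eq_mul] at h1 h2
      have hJq := hJ q hq
      ext
      · refine (mul_eq_zero.1 ?_).resolve_left hJq
        linear_combination pdv 1 v q * h1 - pdv 1 u q * h2
      · refine (mul_eq_zero.1 ?_).resolve_left hJq
        linear_combination pdv 0 u q * h2 - pdv 0 v q * h1
    refine ⟨(LinearEquiv.ofInjectiveEndo _ hinj).toContinuousLinearEquiv, ?_⟩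
    exact hd q hq
  obtain ⟨L₀, hL₀⟩ := hequiv q₀ h₀
  have hc₀ : ContDiffAt ℝ ∞ Ψ q₀ := sΨ.contDiffAt (hU.mem_nhds h₀)
  set Φ := hc₀.toOpenPartialHomeomorph Ψ hL₀ (by simp) with hΦ
  have hΦc : (Φ : ℝ × ℝ → ℝ × ℝ) = Ψ := hc₀.toOpenPartialHomeomorph_coe hL₀ (by simp)
  have hq₀s : q₀ ∈ Φ.source := hc₀.mem_toOpenPartialHomeomorph_source hL₀ (by simp)
  have hW : IsOpen (Φ.target ∩ Φ.symm ⁻¹' U) := Φ.symm.isOpen_inter_preimage hU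
  have hmem : Ψ q₀ ∈ Φ.target ∩ Φ.symm ⁻¹' U := by
    rw [← hΦc]
    refine ⟨Φ.map_source hq₀s, ?_⟩
    rw [mem_preimage, Φ.left_inv hq₀s]
    exact h₀
  -- Balls for the sup norm of `ℝ × ℝ` are squares, so the local inverse of `(u, v)` is defined on a
  -- product of intervals.
  obtain ⟨ε, hε, hball⟩ := Metric.isOpen_iff.1 hW _ hmem
  have hbox : Metric.ball (u q₀) ε ×ˢ Metric.ball (v q₀) ε ⊆ Φ.target ∩ Φ.symm ⁻¹' U := by
    rwa [ball_prod_same]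
  have hint : ∀ t : ℝ, IsOpenInterval (Metric.ball t ε) := fun t =>
    ⟨Metric.isOpen_ball, by rw [Real.ball_eq_Ioo]; exact ordConnected_Ioo⟩
  set V := Metric.ball (u q₀) ε ×ˢ Metric.ball (v q₀) ε with hV
  have hVo : IsOpen V := Metric.isOpen_ball.prod Metric.isOpen_ball
  have hψ : ContDiffOn ℝ ∞ Φ.symm V := by
    intro r hr
    obtain ⟨L, hL⟩ := hequiv (Φ.symm r) (hbox hr).2
    refine (Φ.contDiffAt_symm (hbox hr).1 (f₀' := L) ?_ ?_).contDiffWithinAt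
    · rwa [hΦc]
    · rw [hΦc]
      exact sΨ.contDiffAt (hU.mem_nhds (hbox hr).2)
  have hder : ∀ r ∈ V, ∀ w, fderiv ℝ u (Φ.symm r) (fderiv ℝ Φ.symm r w) = w.1 ∧
      fderiv ℝ v (Φ.symm r) (fderiv ℝ Φ.symm r w) = w.2 := by
    intro r hr w
    have h1 := (hd _ (hbox hr).2).comp r (hψ.differentiableAt_of_isOpen hVo hr).hasFDerivAt
    have h2 : Ψ ∘ Φ.symm =ᶠ[nhds r] id := by
      filter_upwards [hVo.mem_nhds hr] with s hs
      rw [← hΦc]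
      exact Φ.right_inv (hbox hs).1
    have h3 := (h1.congr_of_eventuallyEq h2.symm).unique (hasFDerivAt_id r)
    have h4 := congrArg (fun L => L w) h3
    exact ⟨congrArg Prod.fst h4, congrArg Prod.snd h4⟩
  refine ⟨_, _, Φ.symm, hint _, hint _, ⟨hVo, hψ, fun r hr => (hbox hr).2,
    Φ.symm.injOn.mono fun r hr => (hbox hr).1, fun O hO hOo =>
      Φ.symm.isOpen_image_of_subset_source hOo fun r hr => (hbox (hO hr)).1, fun r hr => ?_⟩,
    ⟨Ψ q₀, ⟨Metric.mem_ball_self hε, Metric.mem_ball_self hε⟩, ?_⟩, hder⟩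
  · have hinj : Function.Injective (fderiv ℝ Φ.symm r).toLinearMap := by
      rw [← LinearMap.ker_eq_bot, LinearMap.ker_eq_bot']
      intro w hw
      have h1 := hder r hr w
      have hw' : fderiv ℝ Φ.symm r w = 0 := hw
      rw [hw', map_zero, map_zero] at h1
      exact Prod.ext h1.1.symm h1.2.symm
    exact ⟨hinj, LinearMap.injective_iff_surjective.1 hinj⟩
  · rw [← hΦc]
    exact Φ.left_inv hq₀s

/-! ### The frame field of a null coframe -/

theorem tri_plane_smul (vol : VolumeForm) (f₁ g₁ f₂ g₂ k : ℝ) (y z v : A3) :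
    tri vol (f₁ • y + g₁ • z) (f₂ • y + g₂ • z) (k • v) =
      (f₁ * g₂ - g₁ * f₂) * k * tri vol y z v := by
  simp only [tri_eq, Pi.add_apply, Pi.smul_apply, smul_eq_mul]
  ring

theorem tri_combination (vol : VolumeForm) (f₁ g₁ f₂ g₂ s r t k : ℝ) (y z v w : A3) :
    tri vol (f₁ • y + g₁ • z) (f₂ • y + g₂ • z) ((s • v + r • y) + (t • w + k • z)) =
      (f₁ * g₂ - g₁ * f₂) * (s * tri vol y z v + t * tri vol y z w) := by
  simp only [tri_eq, Pi.add_apply, Pi.smul_apply, smul_eq_mul]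
  ring

theorem tri_smul_add_smul (vol : VolumeForm) (y z v w : A3) (s t : ℝ) :
    tri vol y z (s • v + t • w) = s * tri vol y z v + t * tri vol y z w := by
  simp only [tri_eq, Pi.add_apply, Pi.smul_apply, smul_eq_mul]
  ring

/-- The frame field whose first two vectors are dual to the coframe `a ds + b dt, c ds + d dt`,
and whose third vector has the constant direction `N`. -/
noncomputable def coframeFrame (vol : VolumeForm) (x : ℝ × ℝ → A3) (N : A3)
    (a b c d : ℝ × ℝ → ℝ) (q : ℝ × ℝ) : Fin 3 → A3 :=
  ![(d q / (a q * d q - b q * c q)) • pdv 0 x q + (-c q / (a q * d q - b q * c q)) • pdv 1 x q,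
    (-b q / (a q * d q - b q * c q)) • pdv 0 x q + (a q / (a q * d q - b q * c q)) • pdv 1 x q,
    ((a q * d q - b q * c q) / tri vol (pdv 0 x q) (pdv 1 x q) N) • N]

section CoframeFrame

variable {vol : VolumeForm} {U : Set (ℝ × ℝ)} {x : ℝ × ℝ → A3} {N : A3} {a b c d : ℝ × ℝ → ℝ}
  {q : ℝ × ℝ}

/-- The first two vectors have area `D⁻¹` relative to `x_s, x_t`, so the scaling of `N` in the third
vector restores volume 1. -/
theorem coframeFrame_isZeroAdapted (hU : IsOpen U) (hx : ContDiffOn ℝ ∞ x U)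
    (hN : ∀ q ∈ U, tri vol (pdv 0 x q) (pdv 1 x q) N ≠ 0) (ha : ContDiffOn ℝ ∞ a U)
    (hb : ContDiffOn ℝ ∞ b U) (hc : ContDiffOn ℝ ∞ c U) (hd : ContDiffOn ℝ ∞ d U)
    (hD : ∀ q ∈ U, a q * d q - b q * c q ≠ 0) :
    IsZeroAdapted vol x U (coframeFrame vol x N a b c d) := by
  have s0 := hx.pdv hU 0
  have s1 := hx.pdv hU 1
  have sD : ContDiffOn ℝ ∞ (fun q => a q * d q - b q * c q) U := (ha.mul hd).sub (hb.mul hc)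
  refine ⟨⟨fun i => ?_, fun q hq => ?_⟩, fun q hq => ?_⟩
  · fin_cases i
    · exact ((hd.div sD hD).smul s0).add ((hc.neg.div sD hD).smul s1)
    · exact ((hb.neg.div sD hD).smul s0).add ((ha.div sD hD).smul s1)
    · exact (sD.div (ContDiffOn.tri vol s0 s1 contDiffOn_const) hN).smul contDiffOn_const
  · have hNq := hN q hq
    have hDq := hD q hq
    rw [vol_eq_tri]
    simp only [coframeFrame, Matrix.cons_val_zero, Matrix.cons_val_one, Matrix.cons_val,
      tri_plane_smul]
    have hdet : d q / (a q * d q - b q * c q) * (a q / (a q * d q - b q * c q)) -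
        -c q / (a q * d q - b q * c q) * (-b q / (a q * d q - b q * c q)) =
        (a q * d q - b q * c q)⁻¹ := by
      field_simp
    rw [hdet, mul_assoc, div_mul_cancel₀ _ hNq, inv_mul_cancel₀ hDq]
  · have hDq := hD q hq
    ext z
    rw [Submodule.mem_span_pair, LinearMap.mem_range]
    constructor
    · rintro ⟨s, t, rfl⟩
      refine ⟨(s * (d q / (a q * d q - b q * c q)) + t * (-b q / (a q * d q - b q * c q)),
        s * (-c q / (a q * d q - b q * c q)) + t * (a q / (a q * d q - b q * c q))), ?_⟩
      refine (fderiv_apply_eq_pdv x q _).trans ?_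
      simp only [coframeFrame, Matrix.cons_val_zero, Matrix.cons_val_one]
      module
    · rintro ⟨w, rfl⟩
      refine ⟨a q * w.1 + b q * w.2, c q * w.1 + d q * w.2, ?_⟩
      refine Eq.trans ?_ (fderiv_apply_eq_pdv x q w).symm
      simp only [coframeFrame, Matrix.cons_val_zero, Matrix.cons_val_one]
      have h1 : (a q * w.1 + b q * w.2) * (d q / (a q * d q - b q * c q)) +
          (c q * w.1 + d q * w.2) * (-b q / (a q * d q - b q * c q)) = w.1 := by
        field_simp
        ring
      have h2 : (a q * w.1 + b q * w.2) * (-c q / (a q * d q - b q * c q)) +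
          (c q * w.1 + d q * w.2) * (a q / (a q * d q - b q * c q)) = w.2 := by
        field_simp
        ring
      conv_rhs => rw [← h1, ← h2]
      module

theorem dualForm_coframeFrame (hN : tri vol (pdv 0 x q) (pdv 1 x q) N ≠ 0)
    (hD : a q * d q - b q * c q ≠ 0) (w : ℝ × ℝ) :
    dualForm vol x (coframeFrame vol x N a b c d) 0 q w = a q * w.1 + b q * w.2 ∧
      dualForm vol x (coframeFrame vol x N a b c d) 1 q w = c q * w.1 + d q * w.2 := by
  unfold dualForm
  rw [frameCoeff_zero, frameCoeff_one, fderiv_apply_eq_pdv]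
  simp only [coframeFrame, Matrix.cons_val_zero, Matrix.cons_val_one, Matrix.cons_val,
    tri_plane_smul]
  generalize a q * d q - b q * c q = D at hD ⊢
  generalize tri vol (pdv 0 x q) (pdv 1 x q) N = T at hN ⊢
  constructor
  · field_simp
    ring
  · field_simp
    ring

/-- Derivatives of the coefficients of `e₁, e₂` contribute only tangential terms, so `ω³ᵢ` involves
just the second-order form of `x`; the outer factor `D⁻¹` is the relative area of `e₁, e₂`. -/
theorem connForm_coframeFrame (hU : IsOpen U) (hx : ContDiffOn ℝ ∞ x U) (ha : ContDiffOn ℝ ∞ a U)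
    (hb : ContDiffOn ℝ ∞ b U) (hc : ContDiffOn ℝ ∞ c U) (hd : ContDiffOn ℝ ∞ d U)
    (hD : ∀ q ∈ U, a q * d q - b q * c q ≠ 0) (hq : q ∈ U) {l m n : ℝ}
    (hl : tri vol (pdv 0 x q) (pdv 1 x q) (pdv 0 (pdv 0 x) q) = l)
    (hm : tri vol (pdv 0 x q) (pdv 1 x q) (pdv 1 (pdv 0 x) q) = m)
    (hn : tri vol (pdv 0 x q) (pdv 1 x q) (pdv 1 (pdv 1 x) q) = n) (w : ℝ × ℝ) :
    connForm vol (coframeFrame vol x N a b c d) 2 0 q w = (a q * d q - b q * c q)⁻¹ *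
        (d q / (a q * d q - b q * c q) * (w.1 * l + w.2 * m)
          + -c q / (a q * d q - b q * c q) * (w.1 * m + w.2 * n)) ∧
      connForm vol (coframeFrame vol x N a b c d) 2 1 q w = (a q * d q - b q * c q)⁻¹ *
        (-b q / (a q * d q - b q * c q) * (w.1 * l + w.2 * m)
          + a q / (a q * d q - b q * c q) * (w.1 * m + w.2 * n)) := by
  have s0 := hx.pdv hU 0
  have s1 := hx.pdv hU 1
  have sD : ContDiffOn ℝ ∞ (fun q => a q * d q - b q * c q) U := (ha.mul hd).sub (hb.mul hc)
  have hDq := hD q hq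
  have key : ∀ {f g : ℝ × ℝ → ℝ}, ContDiffOn ℝ ∞ f U → ContDiffOn ℝ ∞ g U →
      tri vol (coframeFrame vol x N a b c d q 0) (coframeFrame vol x N a b c d q 1)
        (fderiv ℝ (fun q => f q • pdv 0 x q + g q • pdv 1 x q) q w) =
      (a q * d q - b q * c q)⁻¹ *
        (f q * (w.1 * l + w.2 * m) + g q * (w.1 * m + w.2 * n)) := by
    intro f g hf hg
    have hdet : d q / (a q * d q - b q * c q) * (a q / (a q * d q - b q * c q)) -
        -c q / (a q * d q - b q * c q) * (-b q / (a q * d q - b q * c q)) =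
        (a q * d q - b q * c q)⁻¹ := by
      field_simp
    rw [fderiv_apply_eq_pdv, tri_smul_add_smul]
    simp only [pdv_smul_add_smul (hf.differentiableAt_of_isOpen hU hq)
      (s0.differentiableAt_of_isOpen hU hq) (hg.differentiableAt_of_isOpen hU hq)
      (s1.differentiableAt_of_isOpen hU hq), coframeFrame, Matrix.cons_val_zero,
      Matrix.cons_val_one, tri_combination, hdet, pdv_comm hU hx 0 1 hq, hl, hm, hn]
    ring
  unfold connForm
  rw [frameCoeff_two, frameCoeff_two]
  exact ⟨key (hd.div sD hD) (hc.neg.div sD hD), key (hb.neg.div sD hD) (ha.div sD hD)⟩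

theorem coframeFrame_isOneAdapted (hU : IsOpen U) (hx : ContDiffOn ℝ ∞ x U)
    (hN : ∀ q ∈ U, tri vol (pdv 0 x q) (pdv 1 x q) N ≠ 0) (ha : ContDiffOn ℝ ∞ a U)
    (hb : ContDiffOn ℝ ∞ b U) (hc : ContDiffOn ℝ ∞ c U) (hd : ContDiffOn ℝ ∞ d U)
    (hD : ∀ q ∈ U, a q * d q - b q * c q ≠ 0)
    (hl : ∀ q ∈ U, (a q * d q - b q * c q) * (2 * (a q * c q)) =
      tri vol (pdv 0 x q) (pdv 1 x q) (pdv 0 (pdv 0 x) q))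
    (hm : ∀ q ∈ U, (a q * d q - b q * c q) * (a q * d q + b q * c q) =
      tri vol (pdv 0 x q) (pdv 1 x q) (pdv 1 (pdv 0 x) q))
    (hn : ∀ q ∈ U, (a q * d q - b q * c q) * (2 * (b q * d q)) =
      tri vol (pdv 0 x q) (pdv 1 x q) (pdv 1 (pdv 1 x) q)) :
    IsOneAdapted vol x U (coframeFrame vol x N a b c d) := by
  refine ⟨coframeFrame_isZeroAdapted hU hx hN ha hb hc hd hD, fun q hq i w => ?_⟩
  have hconn := connForm_coframeFrame (N := N) hU hx ha hb hc hd hD hq (hl q hq).symm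
    (hm q hq).symm (hn q hq).symm w
  have hdual := dualForm_coframeFrame (hN q hq) (hD q hq) w
  have hDq := hD q hq
  have e0 : (Fin.castSucc 0 : Fin 3) = 0 := rfl
  have e1 : (Fin.castSucc 1 : Fin 3) = 1 := rfl
  rw [Fin.sum_univ_two, e0, e1, hdual.1, hdual.2]
  fin_cases i
  · rw [Fin.zero_eta, e0, hconn.1]
    simp only [Matrix.of_apply, Matrix.cons_val_zero, Matrix.cons_val_one]
    field_simp
    ring
  · rw [Fin.mk_one, e1, hconn.2]
    simp only [Matrix.of_apply, Matrix.cons_val_zero, Matrix.cons_val_one]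
    field_simp
    ring

/-- For a 1-adapted frame `ω³₁ = ω²` and `ω³₂ = ω¹`, so `I_aff = 2 ω¹ω²`. -/
theorem affineFirstForm_coframeFrame
    (he : IsOneAdapted vol x U (coframeFrame vol x N a b c d)) (hq : q ∈ U)
    (hN : tri vol (pdv 0 x q) (pdv 1 x q) N ≠ 0) (hD : a q * d q - b q * c q ≠ 0) :
    affineFirstForm vol x (coframeFrame vol x N a b c d) q =
      !![a q * c q + a q * c q, a q * d q + b q * c q;
        a q * d q + b q * c q, b q * d q + b q * d q] := by
  have e0 : (Fin.castSucc 0 : Fin 3) = 0 := rfl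
  have e1 : (Fin.castSucc 1 : Fin 3) = 1 := rfl
  have h0 := he.h_eq q hq 0
  have h1 := he.h_eq q hq 1
  simp only [Fin.sum_univ_two, e0, e1, (dualForm_coframeFrame hN hD _).1,
    (dualForm_coframeFrame hN hD _).2] at h0 h1
  ext i j
  simp only [affineFirstForm, Matrix.of_apply]
  rw [Fin.sum_univ_two, e0, e1, h0, h0, h1, h1]
  simp only [(dualForm_coframeFrame hN hD _).1, (dualForm_coframeFrame hN hD _).2]
  fin_cases i <;> fin_cases j <;> simp [coordVec] <;> ring

end CoframeFrame

/-! ### Existence of asymptotic coordinates on flat hyperbolic surfaces -/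

theorem IsLocalParam.exists_transversal {vol : VolumeForm} (hvol : vol ≠ 0) {S : Set A3}
    {U : Set (ℝ × ℝ)} {x : ℝ × ℝ → A3} (hx : IsLocalParam S U x) {q : ℝ × ℝ} (hq : q ∈ U) :
    ∃ N : A3, tri vol (pdv 0 x q) (pdv 1 x q) N ≠ 0 := by
  by_contra! h
  have hκ := basisVolume_ne_zero hvol
  have h0 := h ![1, 0, 0]
  have h1 := h ![0, 1, 0]
  have h2 := h ![0, 0, 1]
  simp only [tri_eq, mul_eq_zero, hκ, false_or, Matrix.cons_val_zero, Matrix.cons_val_one,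
    Matrix.cons_val] at h0 h1 h2
  apply hx.pdv_ne_zero hq 0
  ext i
  -- If no basis vector is transversal, all 2×2 minors of `(x_u, x_v)` vanish, so this vector lies
  -- in the kernel of the differential; injectivity then kills each component of `x_u`.
  have hz : fderiv ℝ x q (-(pdv 1 x q i), pdv 0 x q i) = 0 := by
    rw [fderiv_apply_eq_pdv]
    ext j
    simp only [Pi.add_apply, Pi.smul_apply, smul_eq_mul, Pi.zero_apply]
    fin_cases i <;> fin_cases j <;> simp only [Fin.zero_eta, Fin.mk_one, Fin.reduceFinMk] <;>
      linarith
  exact congrArg Prod.snd (hx.immersion q hq (hz.trans (map_zero (fderiv ℝ x q)).symm))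

theorem pdv_exp {f : ℝ × ℝ → ℝ} {q : ℝ × ℝ} (hf : DifferentiableAt ℝ f q) (i : Fin 2) :
    pdv i (fun q => Real.exp (f q)) q = Real.exp (f q) * pdv i f q := by
  unfold pdv
  rw [hf.hasFDerivAt.exp.fderiv]
  rfl

/-- A 1-form `a ds + b dt` with integrating factor `exp f`. -/
theorem exists_primitive_exp_mul {U : Set (ℝ × ℝ)} (hU : IsOpen U) (hc : Convex ℝ U)
    {a b f : ℝ × ℝ → ℝ} (ha : ContDiffOn ℝ ∞ a U) (hb : ContDiffOn ℝ ∞ b U)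
    (hf : ContDiffOn ℝ ∞ f U)
    (h : ∀ q ∈ U, pdv 0 b q - pdv 1 a q = pdv 1 f q * a q - pdv 0 f q * b q) :
    ∃ u : ℝ × ℝ → ℝ, ContDiffOn ℝ ∞ u U ∧ ∀ q ∈ U, pdv 0 u q = Real.exp (f q) * a q ∧
      pdv 1 u q = Real.exp (f q) * b q := by
  refine exists_primitive hU hc (hf.exp.mul ha) (hf.exp.mul hb) fun q hq => ?_
  have df := hf.differentiableAt_of_isOpen hU hq
  have dexp := hf.exp.differentiableAt_of_isOpen hU hq
  rw [pdv_mul dexp (hb.differentiableAt_of_isOpen hU hq),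
    pdv_mul dexp (ha.differentiableAt_of_isOpen hU hq), pdv_exp df, pdv_exp df]
  linear_combination Real.exp (f q) * h q hq

/-- A null coframe of a flat metric can be rescaled to a pair of exact forms. -/
theorem exists_flat_coordinates {U : Set (ℝ × ℝ)} (hU : IsOpen U) (hcU : Convex ℝ U)
    {a b c d : ℝ × ℝ → ℝ} (ha : ContDiffOn ℝ ∞ a U) (hb : ContDiffOn ℝ ∞ b U)
    (hc : ContDiffOn ℝ ∞ c U) (hd : ContDiffOn ℝ ∞ d U)
    (hD : ∀ q ∈ U, a q * d q - b q * c q ≠ 0)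
    (hK : ∀ q ∈ U, gaussCurvature (fun q => !![a q * c q + a q * c q, a q * d q + b q * c q;
        a q * d q + b q * c q, b q * d q + b q * d q]) q = 0) :
    ∃ f u v : ℝ × ℝ → ℝ, ContDiffOn ℝ ∞ u U ∧ ContDiffOn ℝ ∞ v U ∧ ∀ q ∈ U,
      pdv 0 u q = Real.exp (-f q) * a q ∧ pdv 1 u q = Real.exp (-f q) * b q ∧
      pdv 0 v q = Real.exp (f q) * c q ∧ pdv 1 v q = Real.exp (f q) * d q := by
  have sD : ContDiffOn ℝ ∞ (fun q => a q * d q - b q * c q) U := (ha.mul hd).sub (hb.mul hc)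
  have s1 := (hb.pdv hU 0).sub (ha.pdv hU 1)
  have s2 := (hd.pdv hU 0).sub (hc.pdv hU 1)
  -- `A` and `B` solve the two structure equations by Cramer's rule; the determinant is `D` up to
  -- sign.
  obtain ⟨A, hAdef⟩ : ∃ A : ℝ × ℝ → ℝ, A = fun q => -((pdv 0 d q - pdv 1 c q) * a q +
      (pdv 0 b q - pdv 1 a q) * c q) / (a q * d q - b q * c q) := ⟨_, rfl⟩
  obtain ⟨B, hBdef⟩ : ∃ B : ℝ × ℝ → ℝ, B = fun q => -((pdv 0 d q - pdv 1 c q) * b q +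
      (pdv 0 b q - pdv 1 a q) * d q) / (a q * d q - b q * c q) := ⟨_, rfl⟩
  have hA : ContDiffOn ℝ ∞ A U := hAdef ▸ ((s2.mul ha).add (s1.mul hc)).neg.div sD hD
  have hB : ContDiffOn ℝ ∞ B U := hBdef ▸ ((s2.mul hb).add (s1.mul hd)).neg.div sD hD
  have kA : ∀ q ∈ U, A q * (a q * d q - b q * c q) = -((pdv 0 d q - pdv 1 c q) * a q +
      (pdv 0 b q - pdv 1 a q) * c q) := fun q hq => by rw [hAdef, div_mul_cancel₀ _ (hD q hq)]
  have kB : ∀ q ∈ U, B q * (a q * d q - b q * c q) = -((pdv 0 d q - pdv 1 c q) * b q +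
      (pdv 0 b q - pdv 1 a q) * d q) := fun q hq => by rw [hBdef, div_mul_cancel₀ _ (hD q hq)]
  have h1 : ∀ q ∈ U, pdv 0 b q - pdv 1 a q = A q * b q - B q * a q := by
    intro q hq
    apply mul_right_cancel₀ (hD q hq)
    linear_combination a q * kB q hq - b q * kA q hq
  have h2 : ∀ q ∈ U, pdv 0 d q - pdv 1 c q = B q * c q - A q * d q := by
    intro q hq
    apply mul_right_cancel₀ (hD q hq)
    linear_combination d q * kA q hq - c q * kB q hq
  obtain ⟨f, hf, hf'⟩ := exists_primitive hU hcU hA hB (by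
    intro q hq
    have hK' := hK q hq
    rw [gaussCurvature, riemann1212_null_coframe hU ha hb hc hd hA hB h1 h2 hq (hD q hq),
      div_eq_zero_iff, Matrix.det_fin_two_of] at hK'
    have hdet : (a q * c q + a q * c q) * (b q * d q + b q * d q) -
        (a q * d q + b q * c q) * (a q * d q + b q * c q) ≠ 0 := by
      have : (a q * c q + a q * c q) * (b q * d q + b q * d q) -
        (a q * d q + b q * c q) * (a q * d q + b q * c q) = -(a q * d q - b q * c q) ^ 2 := by ring
      rw [this]
      exact neg_ne_zero.2 (pow_ne_zero 2 (hD q hq))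
    exact sub_eq_zero.1 ((mul_eq_zero.1 (hK'.resolve_right hdet)).resolve_left (hD q hq)))
  have hneg : ∀ i, ∀ q ∈ U, pdv i (fun q => -f q) q = -pdv i f q := by
    intro i q _
    unfold pdv
    rw [fderiv_fun_neg]
    rfl
  obtain ⟨u, hu, hu'⟩ := exists_primitive_exp_mul hU hcU ha hb hf.neg (by
    intro q hq
    rw [h1 q hq, hneg 0 q hq, hneg 1 q hq, (hf' q hq).1, (hf' q hq).2]
    ring)
  obtain ⟨v, hv, hv'⟩ := exists_primitive_exp_mul hU hcU hc hd hf (by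
    intro q hq
    rw [h2 q hq, (hf' q hq).1, (hf' q hq).2])
  exact ⟨f, u, v, hu, hv, fun q hq => ⟨(hu' q hq).1, (hu' q hq).2, (hv' q hq).1, (hv' q hq).2⟩⟩

/-- Flatness rescales the null coframe to `du, dv`; the 1-adapted frame dual to `du, dv` consists,
in the coordinates `u, v`, of `x_u, x_v` and a multiple of `N`. -/
theorem exists_isAsymptotic {vol : VolumeForm} (hvol : vol ≠ 0) {S : Set A3}
    (hS : IsRegularSurface S) (hhyp : IsHyperbolic vol S) (hflat : IsAffineFlat vol S)
    {p : A3} (hp : p ∈ S) :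
    ∃ (I J : Set ℝ) (x : ℝ × ℝ → A3), IsOpenInterval I ∧ IsOpenInterval J ∧
      IsLocalParam S (I ×ˢ J) x ∧ p ∈ x '' (I ×ˢ J) ∧ IsAsymptotic vol (I ×ˢ J) x := by
  obtain ⟨U₀, x, hx₀, q₀, hq₀, rfl⟩ := hS p hp
  obtain ⟨N, hN₀⟩ := hx₀.exists_transversal hvol hq₀
  have hrestrict : ∀ {V : Set (ℝ × ℝ)}, IsOpen V → V ⊆ U₀ → IsLocalParam S V x := fun hV h =>
    (IsReparam.id_of_subset hV h).isLocalParam hx₀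
  have sT := ContDiffOn.tri vol (hx₀.smooth.pdv hx₀.isOpen 0) (hx₀.smooth.pdv hx₀.isOpen 1)
    (contDiffOn_const (c := N))
  obtain ⟨U, hUprop, hU, hqU⟩ := eventually_nhds_iff.1
    (((sT.continuousOn.continuousAt (hx₀.isOpen.mem_nhds hq₀)).eventually_ne hN₀).and
      (hx₀.isOpen.mem_nhds hq₀))
  have hUU₀ : U ⊆ U₀ := fun q hq => (hUprop q hq).2
  have hx := hrestrict hU hUU₀
  have s0 := hx.smooth.pdv hU 0
  have s1 := hx.smooth.pdv hU 1
  -- Hyperbolicity is tested on the frame dual to `ds, dt`, whose `h` is the second-order form of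
  -- `x` itself.
  have hdet := hhyp U x (coframeFrame vol x N (fun _ => 1) (fun _ => 0) (fun _ => 0) fun _ => 1) hx
    (coframeFrame_isZeroAdapted hU hx.smooth (fun q hq => (hUprop q hq).1) contDiffOn_const
      contDiffOn_const contDiffOn_const contDiffOn_const (by simp)) q₀ hqU
    !![tri vol (pdv 0 x q₀) (pdv 1 x q₀) (pdv 0 (pdv 0 x) q₀),
      tri vol (pdv 0 x q₀) (pdv 1 x q₀) (pdv 1 (pdv 0 x) q₀);
      tri vol (pdv 0 x q₀) (pdv 1 x q₀) (pdv 1 (pdv 0 x) q₀),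
      tri vol (pdv 0 x q₀) (pdv 1 x q₀) (pdv 1 (pdv 1 x) q₀)] (by
      intro i w
      have hconn := connForm_coframeFrame (vol := vol) (N := N) (a := fun _ => 1) (b := fun _ => 0)
        (c := fun _ => 0) (d := fun _ => 1) hU hx.smooth contDiffOn_const contDiffOn_const
        contDiffOn_const contDiffOn_const (by simp) hqU rfl rfl rfl w
      have hdual := dualForm_coframeFrame (vol := vol) (x := x) (a := fun _ => 1) (b := fun _ => 0)
        (c := fun _ => 0) (d := fun _ => 1) hN₀ (by simp) w
      have e0 : (Fin.castSucc 0 : Fin 3) = 0 := rfl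
      have e1 : (Fin.castSucc 1 : Fin 3) = 1 := rfl
      rw [Fin.sum_univ_two, e0, e1, hdual.1, hdual.2]
      fin_cases i
      · rw [Fin.zero_eta, e0, hconn.1]
        simp
        ring
      · rw [Fin.mk_one, e1, hconn.2]
        simp
        ring)
  rw [Matrix.det_fin_two_of] at hdet
  obtain ⟨V₀, a, b, c, d, hV₀, hqV₀, hV₀U, ha, hb, hc, hd, habcd⟩ := exists_null_coframe hU hqU
    (ContDiffOn.tri vol s0 s1 (s0.pdv hU 0)) (ContDiffOn.tri vol s0 s1 (s0.pdv hU 1))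
    (ContDiffOn.tri vol s0 s1 (s1.pdv hU 1)) hdet
  -- Shrinking to a ball gives the convexity needed for primitives.
  obtain ⟨ε, hε, hball⟩ := Metric.isOpen_iff.1 hV₀ _ hqV₀
  have hV : IsOpen (Metric.ball q₀ ε) := Metric.isOpen_ball
  have hcV : Convex ℝ (Metric.ball q₀ ε) := convex_ball _ _
  have hqV : q₀ ∈ Metric.ball q₀ ε := Metric.mem_ball_self hε
  generalize Metric.ball q₀ ε = V at hball hV hcV hqV
  have hVU := hball.trans hV₀U
  replace hx := hrestrict hV (hVU.trans hUU₀)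
  replace ha := ha.mono hball
  replace hb := hb.mono hball
  replace hc := hc.mono hball
  replace hd := hd.mono hball
  replace habcd := fun q hq => habcd q (hball hq)
  have hN : ∀ q ∈ V, tri vol (pdv 0 x q) (pdv 1 x q) N ≠ 0 := fun q hq => (hUprop q (hVU hq)).1
  have hD : ∀ q ∈ V, a q * d q - b q * c q ≠ 0 := fun q hq => (habcd q hq).1
  have he := coframeFrame_isOneAdapted hV hx.smooth hN ha hb hc hd hD
    (fun q hq => (habcd q hq).2.1) (fun q hq => (habcd q hq).2.2.1)
    (fun q hq => (habcd q hq).2.2.2)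
  obtain ⟨f, u, v, hu, hv, huv⟩ := exists_flat_coordinates hV hcV ha hb hc hd hD (by
    intro q hq
    rw [← hflat V x _ hx he q hq]
    exact (gaussCurvature_congr hV
      (fun q hq => affineFirstForm_coframeFrame he hq (hN q hq) (hD q hq)) hq).symm)
  have hexp : ∀ q, Real.exp (-f q) * Real.exp (f q) = 1 := fun q => by
    rw [← Real.exp_add, neg_add_cancel, Real.exp_zero]
  -- The factors `e^{-f}` and `e^{f}` cancel in every product of a coefficient of `du` with one of
  -- `dv`. Hence `D` and the three second-order identities carry over, and the frame dual to `du,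
  -- dv` is again 1-adapted.
  have h00 : ∀ q ∈ V, pdv 0 u q * pdv 0 v q = a q * c q := fun q hq => by
    obtain ⟨e1, e2, e3, e4⟩ := huv q hq
    rw [e1, e3]
    linear_combination a q * c q * hexp q
  have h01 : ∀ q ∈ V, pdv 0 u q * pdv 1 v q = a q * d q := fun q hq => by
    obtain ⟨e1, e2, e3, e4⟩ := huv q hq
    rw [e1, e4]
    linear_combination a q * d q * hexp q
  have h10 : ∀ q ∈ V, pdv 1 u q * pdv 0 v q = b q * c q := fun q hq => by
    obtain ⟨e1, e2, e3, e4⟩ := huv q hq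
    rw [e2, e3]
    linear_combination b q * c q * hexp q
  have h11 : ∀ q ∈ V, pdv 1 u q * pdv 1 v q = b q * d q := fun q hq => by
    obtain ⟨e1, e2, e3, e4⟩ := huv q hq
    rw [e2, e4]
    linear_combination b q * d q * hexp q
  have hD' : ∀ q ∈ V, pdv 0 u q * pdv 1 v q - pdv 1 u q * pdv 0 v q ≠ 0 := fun q hq => by
    rw [h01 q hq, h10 q hq]
    exact hD q hq
  have he' : IsOneAdapted vol x V
      (coframeFrame vol x N (pdv 0 u) (pdv 1 u) (pdv 0 v) (pdv 1 v)) := by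
    refine coframeFrame_isOneAdapted hV hx.smooth hN (hu.pdv hV 0) (hu.pdv hV 1) (hv.pdv hV 0)
      (hv.pdv hV 1) hD' (fun q hq => ?_) (fun q hq => ?_) (fun q hq => ?_)
    · rw [h00 q hq, h01 q hq, h10 q hq]
      exact (habcd q hq).2.1
    · rw [h01 q hq, h10 q hq]
      exact (habcd q hq).2.2.1
    · rw [h11 q hq, h01 q hq, h10 q hq]
      exact (habcd q hq).2.2.2
  obtain ⟨I, J, ψ, hI, hJ, hψ, hqψ, hder⟩ := exists_isReparam hV hqV hu hv hD'
  have hy := hψ.isLocalParam hx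
  have hpdv : ∀ r ∈ I ×ˢ J, ∀ i, pdv i (x ∘ ψ) r =
      (fderiv ℝ ψ r (coordVec i)).1 • pdv 0 x (ψ r) +
        (fderiv ℝ ψ r (coordVec i)).2 • pdv 1 x (ψ r) := by
    intro r hr i
    rw [← fderiv_apply_eq_pdv, pdv, hψ.fderiv_comp hV hx.smooth hr]
    rfl
  refine ⟨I, J, x ∘ ψ, hI, hJ, hy, ?_, (hψ.isOneAdapted hV hx.smooth he').isAsymptotic hy.isOpen
    hy.smooth (fun r hr => ?_) (fun r hr => ?_)⟩
  · rw [image_comp]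
    exact mem_image_of_mem x hqψ
  -- The Jacobian of `ψ` inverts that of `(u, v)`; solving for its first column gives the
  -- coefficients of the first dual frame vector.
  · obtain ⟨k1, k2⟩ := hder r hr (coordVec 0)
    have hDr := hD' _ (hψ.mapsTo hr)
    rw [fderiv_apply_eq_pdv, smul_eq_mul, smul_eq_mul] at k1 k2
    simp only [coordVec, if_true] at k1 k2
    rw [hpdv r hr 0]
    simp only [Function.comp_apply, coframeFrame, Matrix.cons_val_zero, coordVec, if_true]
    congr 2
    · rw [div_eq_iff hDr]
      linear_combination pdv 1 u (ψ r) * k2 - pdv 1 v (ψ r) * k1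
    · rw [div_eq_iff hDr]
      linear_combination pdv 0 v (ψ r) * k1 - pdv 0 u (ψ r) * k2
  · obtain ⟨k1, k2⟩ := hder r hr (coordVec 1)
    have hDr := hD' _ (hψ.mapsTo hr)
    rw [fderiv_apply_eq_pdv, smul_eq_mul, smul_eq_mul] at k1 k2
    simp only [coordVec, one_ne_zero, if_false] at k1 k2
    rw [hpdv r hr 1]
    simp only [Function.comp_apply, coframeFrame, Matrix.cons_val_one, Matrix.cons_val_zero,
      coordVec, one_ne_zero, if_false]
    congr 2
    · rw [div_eq_iff hDr]
      linear_combination pdv 1 u (ψ r) * k2 - pdv 1 v (ψ r) * k1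
    · rw [div_eq_iff hDr]
      linear_combination pdv 0 v (ψ r) * k1 - pdv 0 u (ψ r) * k2

end Equiaffine

theorem mainTheorem2 (vol : Equiaffine.VolumeForm) (hvol : vol ≠ 0) (S : Set Equiaffine.A3)
    (hS : Equiaffine.IsRegularSurface S) (hhyp : Equiaffine.IsHyperbolic vol S)
    (hflat : Equiaffine.IsAffineFlat vol S) (hmin : Equiaffine.IsAffineMinimal vol S) :
    Equiaffine.IsRuledSurface S ∧
    (∀ p ∈ S, ∃ (I J : Set ℝ) (x : ℝ × ℝ → Equiaffine.A3),
      Equiaffine.IsOpenInterval I ∧ Equiaffine.IsOpenInterval J ∧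
      Equiaffine.IsAdaptedCoords vol S (I ×ˢ J) x ∧ p ∈ x '' (I ×ˢ J) ∧
      Equiaffine.IsStraightInU I J x) ∧
    (∀ (I J : Set ℝ) (x : ℝ × ℝ → Equiaffine.A3),
      Equiaffine.IsOpenInterval I → Equiaffine.IsOpenInterval J →
      Equiaffine.IsAdaptedCoords vol S (I ×ˢ J) x →
      Equiaffine.IsStraightInU I J x ∨ Equiaffine.IsStraightInU J I (x ∘ Prod.swap)) := by
  have key : ∀ p ∈ S, ∃ (I J : Set ℝ) (x : ℝ × ℝ → Equiaffine.A3),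
      Equiaffine.IsOpenInterval I ∧ Equiaffine.IsOpenInterval J ∧
      Equiaffine.IsAdaptedCoords vol S (I ×ˢ J) x ∧ p ∈ x '' (I ×ˢ J) ∧
      Equiaffine.IsStraightInU I J x := by
    intro p hp
    obtain ⟨I, J, x, hI, hJ, hx, ⟨q, hq, hqp⟩, ha⟩ :=
      Equiaffine.exists_isAsymptotic hvol hS hhyp hflat hp
    have hadapted := ha.isAdaptedCoords hx
    rcases ha.isStraightInU_or_swap hI hJ hmin hx with h | h
    · exact ⟨I, J, x, hI, hJ, hadapted, ⟨q, hq, hqp⟩, h⟩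
    -- If the `v`-curves are the straight ones, the parameters are interchanged, which preserves
    -- adapted coordinates because both orders are admitted.
    · exact ⟨J, I, x ∘ Prod.swap, hJ, hI, hadapted.swap hI.1 hJ.1, ⟨q.swap, ⟨hq.2, hq.1⟩, hqp⟩, h⟩
  refine ⟨fun p hp => ?_, key, fun I J x hI hJ hx => hx.isStraightInU_or_swap hI hJ hmin⟩
  obtain ⟨I, J, x, hI, hJ, hx, hpx, h⟩ := key p hp
  exact ⟨I, J, x, hI, hJ, hx.1, hpx, h⟩
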